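/- Fix a rate $\lambda>0$ and a probability law $\nu$ on $[0,\infty)$. A source generates updates at the points of a Poisson process of rate $\lambda$; update $n$ is generated at time $t_n$, belongs to stream $i\in\{1,\dots,M\}$ with probability $p_i$ (where $p_i\ge 0$, $\sum_i p_i=1$), and requires a service time $S_n$ with law $\nu$. All the stream choices, service times and interarrival times are mutually independent. Updates are sent through an M/G/1/1 queue with preemption: each update enters service when it is generated, preempting the update in service, if any; hence update $n$ is received by the monitor, at time $t_n+S_n$, if and only if $t_n+S_n<t_{n+1}$, and otherwise it is lost. The age of stream $i$ at time $t$ is $\Delta_i(t)=t-u_i(t)$, where $u_i(t)$ is the generation time of the last update of stream $i$ received by time $t$ (and an arbitrary constant before the first reception). Let $K^{(i)}_j$ be the left limit of $\Delta_i(\cdot)$ at the $j$-th reception of an update of stream $i$. The average age and the average peak age of stream $i$ are the limits $$\Delta_i=\lim_{\tau\to\infty}\frac1\tau\int_0^\tau\Delta_i(t)\,dt,\qquad \Delta_{\mathrm{peak},i}=\lim_{N\to\infty}\frac1N\sum_{j=1}^N K^{(i)}_j .$$ Then, for every stream $i$ with $p_i>0$, almost surely infinitely many updates of stream $i$ are received,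 and both limits exist almost surely and are finite deterministic constants. Moreover: 1. for all streams $i,k$ with $p_i,p_k>0$: $\Delta_k<\Delta_i$ if and only if $p_k>p_i$, and $\Delta_{\mathrm{peak},k}<\Delta_{\mathrm{peak},i}$ if and only if $p_k>p_i$. Consider also a second such system with the same $M$, $\lambda$ and $\nu$, with choice probabilities $p'_1,\dots,p'_M$ and with averages $\Delta'_i$, $\Delta'_{\mathrm{peak},i}$ (for $p'_i>0$). Then: 2. for every stream $k$ with $p_k,p'_k>0$: $\Delta'_k<\Delta_k$ if and only if $p'_k>p_k$, and $\Delta'_{\mathrm{peak},k}<\Delta_{\mathrm{peak},k}$ if and only if $p'_k>p_k$; 3. if $0<p_k<p'_k$ and $0<p'_j\le p_j$, then $\Delta'_k-\Delta'_j<\Delta_k-\Delta_j$ and $\Delta'_{\mathrm{peak},k}-\Delta'_{\mathrm{peak},j}<\Delta_{\mathrm{peak},k}-\Delta_{\mathrm{peak},j}$. Thus, for a fixed total rate, raising $p_k$ lowers the average age and the average peak age of stream $k$, both absolutely and with respect to every stream that is not raised as well. -/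

import Mathlib

open MeasureTheory ProbabilityTheory Filter Topology

noncomputable section

namespace StatusUpdate

/-- The law on the streams `0, …, M - 1` which chooses stream `i` with probability `p i`. -/
def streamLaw {M : ℕ} (p : Fin M → ℝ) : Measure (Fin M) :=
  ∑ i, ENNReal.ofReal (p i) • Measure.dirac i

/-- The random data of the source and of the server, on a probability space `(Ω, P)`. Updates are
numbered `0, 1, 2, …` in the order of their generation:
* `X 0` is the generation time of update `0`, and `X (n + 1)` is the time between the generations of
  updates `n` and `n + 1`;
* `S n` is the service time which update `n` requires;
* `c n` is the stream to which update `n` belongs.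

The triples `(X n, S n, c n)` are i.i.d. and their three components are independent. `X n` is
exponential with rate `r`, so that updates are generated by a Poisson process of rate `r`; `S n` has
the law `ν`; and `c n = i` with probability `p i`. -/
structure IsSource {Ω : Type*} [MeasurableSpace Ω] (P : Measure Ω) {M : ℕ} (r : ℝ)
    (ν : Measure ℝ) (p : Fin M → ℝ) (X S : ℕ → Ω → ℝ) (c : ℕ → Ω → Fin M) : Prop where
  measurable_interarrival : ∀ n, Measurable (X n)
  measurable_service : ∀ n, Measurable (S n)
  measurable_stream : ∀ n, Measurable (c n)
  indep : iIndepFun (fun n ω => (X n ω, S n ω, c n ω)) P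
  law : ∀ n, P.map (fun ω => (X n ω, S n ω, c n ω)) = (expMeasure r).prod (ν.prod (streamLaw p))

section Path

/-! One sample path: `x`, `s`, `c` are the values of the interarrival times, the service times and
the streams of the successive updates. -/

variable {M : ℕ} (x s : ℕ → ℝ) (c : ℕ → Fin M)

/-- The generation time of update `n`. -/
def genTime (n : ℕ) : ℝ := ∑ k ∈ Finset.range (n + 1), x k

/-- The time at which the service of update `n` ends, unless it is preempted. Update `n` enters
service as soon as it is generated, since it preempts whatever is in the system. -/
def deliveryTime (n : ℕ) : ℝ := genTime x n + s n

/-- Update `n` belongs to stream `i` and is successfully received: its service ends before the next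
update, of whatever stream, is generated and preempts it. -/
def Successful (i : Fin M) (n : ℕ) : Prop :=
  c n = i ∧ deliveryTime x s n < genTime x (n + 1)

/-- The updates of stream `i` that the monitor has received by time `t`. -/
def received (i : Fin M) (t : ℝ) : Set ℕ :=
  {n | Successful x s c i n ∧ deliveryTime x s n ≤ t}

open Classical in
/-- The generation time `u(t)` of the last update of stream `i` received by time `t`; as long as
there is none, it is the time stamp `u₀` of what the monitor knows at the start. -/
def lastGenTime (u₀ : ℝ) (i : Fin M) (t : ℝ) : ℝ :=
  if (received x s c i t).Nonempty then genTime x (sSup (received x s c i t)) else u₀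

/-- The instantaneous age `t - u(t)` of stream `i` at time `t`. -/
def age (u₀ : ℝ) (i : Fin M) (t : ℝ) : ℝ := t - lastGenTime x s c u₀ i t

/-- The time at which the monitor receives an update of stream `i` for the `j`-th time (`j` is
counted from `0`). -/
def receptionTime (i : Fin M) (j : ℕ) : ℝ :=
  deliveryTime x s (Nat.nth (Successful x s c i) j)

/-- The `j`-th peak age of stream `i`: the left limit of the instantaneous age at the `j`-th
reception. -/
def peakAge (u₀ : ℝ) (i : Fin M) (j : ℕ) : ℝ :=
  Function.leftLim (age x s c u₀ i) (receptionTime x s c i j)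

end Path

section Averages

variable {Ω : Type*} [MeasurableSpace Ω] (P : Measure Ω) {M : ℕ} (X S : ℕ → Ω → ℝ)
  (c : ℕ → Ω → Fin M)

/-- The average age of stream `i` exists and equals the constant `a`: almost surely, the time
average of the instantaneous age over `[0, τ]` tends to `a`. -/
def HasAverageAge (u₀ : ℝ) (i : Fin M) (a : ℝ) : Prop :=
  ∀ᵐ ω ∂P, Tendsto
    (fun τ : ℝ => 1 / τ * ∫ t in (0 : ℝ)..τ, age (X · ω) (S · ω) (c · ω) u₀ i t) atTop (𝓝 a)

/-- The average peak age of stream `i` exists and equals the constant `a`: almost surely, stream `i`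
is received infinitely often and the mean of its first `N` peak ages tends to `a`. -/
def HasAveragePeakAge (u₀ : ℝ) (i : Fin M) (a : ℝ) : Prop :=
  ∀ᵐ ω ∂P, {n | Successful (X · ω) (S · ω) (c · ω) i n}.Infinite ∧ Tendsto
    (fun N : ℕ => 1 / (N : ℝ) * ∑ j ∈ Finset.range N, peakAge (X · ω) (S · ω) (c · ω) u₀ i j)
    atTop (𝓝 a)

end Averages

end StatusUpdate

end

/-! Both averages have closed forms. Let `q = E exp(-r S)` be the probability that an update is
received. The average age of stream `i` is `1 / (r q p i)`, and the average peak age exceeds it by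
`E[S; S < X] / q`, with `X` exponential of rate `r` and independent of `S`. This excess depends
neither on the stream nor on the choice probabilities. All comparisons then reduce to the strict
monotonicity of `x ↦ 1 / x`.

The system is observed at generation times. The age `a n` when update `n` is generated obeys `a (n +
1) = (1 - χ n) * a n + X (n + 1)`, where `χ n` indicates a success of stream `i`. The area under the
age up to the next generation is `a n * (X (n + 1) - χ n * (X (n + 1) - S n)) + X (n + 1) ^ 2 / 2`.
Here `a n` is, up to its initial value, a function of the past innovations `(X (k + 1), S k, c k)`,
`k < n`, and the `n`-th innovation is independent of them. The strong law needed for such products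
is `ae_tendsto_average_chain_mul`: a martingale bounded in `L²` and Kronecker's lemma replace the
innovation by its mean, and the balance of growth and resets gives the mean of `a n`.

Peak ages need no such product: the ages at successful updates telescope to a difference of time
stamps (`sum_ageAt_add_service`). All second moments are controlled by `X`, because a received
update has `S < X`; hence `ν` needs no moments. -/

namespace StatusUpdate

/-! ### The age on one sample path, between successive generations -/

section PathLemmas

variable {M : ℕ} {x s : ℕ → ℝ} {c : ℕ → Fin M} {u₀ : ℝ} {i : Fin M}

open Classical in
/-- The generation time of the last successful update of stream `i` among the first `n` updates,
or `u₀` if there is none. -/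
noncomputable def timeStamp (x s : ℕ → ℝ) (c : ℕ → Fin M) (u₀ : ℝ) (i : Fin M) : ℕ → ℝ
  | 0 => u₀
  | n + 1 => if Successful x s c i n then genTime x n else timeStamp x s c u₀ i n

/-- The age of stream `i` when update `n` is generated, before update `n` is delivered. -/
noncomputable def ageAt (x s : ℕ → ℝ) (c : ℕ → Fin M) (u₀ : ℝ) (i : Fin M) (n : ℕ) : ℝ :=
  genTime x n - timeStamp x s c u₀ i n

open Classical in
/-- The integral of the age of stream `i` between the generations of updates `n` and `n + 1`. -/
noncomputable def ageArea (x s : ℕ → ℝ) (c : ℕ → Fin M) (u₀ : ℝ) (i : Fin M) (n : ℕ) : ℝ :=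
  ageAt x s c u₀ i n * x (n + 1) + x (n + 1) ^ 2 / 2 -
    if Successful x s c i n then ageAt x s c u₀ i n * (x (n + 1) - s n) else 0

lemma genTime_succ (n : ℕ) : genTime x (n + 1) = genTime x n + x (n + 1) := by
  simp [genTime, Finset.sum_range_succ _ (n + 1)]

lemma genTime_zero : genTime x 0 = x 0 := by simp [genTime]

lemma genTime_strictMono (hx : ∀ n, 0 < x n) : StrictMono (genTime x) :=
  strictMono_nat_of_lt_succ fun n => by rw [genTime_succ]; linarith [hx (n + 1)]

lemma timeStamp_succ_of_successful {n : ℕ} (h : Successful x s c i n) :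
    timeStamp x s c u₀ i (n + 1) = genTime x n := by simp [timeStamp, h]

lemma timeStamp_succ_of_not {n : ℕ} (h : ¬ Successful x s c i n) :
    timeStamp x s c u₀ i (n + 1) = timeStamp x s c u₀ i n := by simp [timeStamp, h]

-- This recursion is what makes the age a chain: a success brings the time stamp to the current
-- generation time, after which one interarrival time elapses.
open Classical in
lemma ageAt_succ (n : ℕ) : ageAt x s c u₀ i (n + 1) =
    (if Successful x s c i n then 0 else ageAt x s c u₀ i n) + x (n + 1) := by
  unfold ageAt
  rw [genTime_succ, timeStamp]
  split_ifs <;> ring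

open Classical in
lemma timeStamp_eq (n : ℕ) : (if {m | m < n ∧ Successful x s c i m}.Nonempty then
    genTime x (sSup {m | m < n ∧ Successful x s c i m}) else u₀) = timeStamp x s c u₀ i n := by
  induction n with
  | zero => simp [timeStamp]
  | succ n ih =>
    by_cases h : Successful x s c i n
    · have : IsGreatest {m | m < n + 1 ∧ Successful x s c i m} n :=
        ⟨⟨by omega, h⟩, fun m hm => by have := hm.1; omega⟩
      rw [this.csSup_eq, if_pos ⟨n, this.1⟩, timeStamp_succ_of_successful h]
    · have : {m | m < n + 1 ∧ Successful x s c i m} = {m | m < n ∧ Successful x s c i m} := by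
        ext m
        refine ⟨fun hm => ⟨?_, hm.2⟩, fun hm => ⟨by have := hm.1; omega, hm.2⟩⟩
        have h1 : m ≠ n := fun e => h (e ▸ hm.2)
        have := hm.1
        omega
      rw [this, ih, timeStamp_succ_of_not h]

/-- Under these hypotheses the received updates are exactly the successful ones with index below
`n`, so the supremum in `lastGenTime` is the one computed recursively by `timeStamp`. -/
lemma lastGenTime_eq_timeStamp {n : ℕ} {t : ℝ}
    (h₁ : ∀ m < n, Successful x s c i m → deliveryTime x s m ≤ t)
    (h₂ : ∀ m, n ≤ m → Successful x s c i m → t < deliveryTime x s m) :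
    lastGenTime x s c u₀ i t = timeStamp x s c u₀ i n := by
  have : received x s c i t = {m | m < n ∧ Successful x s c i m} := by
    ext m
    refine ⟨fun hm => ⟨?_, hm.1⟩, fun hm => ⟨hm.2, h₁ m hm.1 hm.2⟩⟩
    by_contra hn
    exact absurd hm.2 (not_le.2 (h₂ m (not_lt.1 hn) hm.1))
  rw [← timeStamp_eq, lastGenTime, this]

lemma Successful.deliveryTime_lt (hx : ∀ n, 0 < x n) {m n : ℕ} (h : Successful x s c i m)
    (hmn : m < n) : deliveryTime x s m < genTime x n :=
  h.2.trans_le ((genTime_strictMono hx).monotone hmn)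

lemma genTime_le_deliveryTime (hs : ∀ n, 0 ≤ s n) (n : ℕ) : genTime x n ≤ deliveryTime x s n := by
  unfold deliveryTime; linarith [hs n]

lemma lastGenTime_before_delivery (hx : ∀ n, 0 < x n) (hs : ∀ n, 0 ≤ s n) {n : ℕ} {t : ℝ}
    (h₁ : genTime x n ≤ t) (h₂ : t < genTime x (n + 1))
    (h₃ : Successful x s c i n → t < deliveryTime x s n) :
    lastGenTime x s c u₀ i t = timeStamp x s c u₀ i n := by
  refine lastGenTime_eq_timeStamp (fun m hm h => ((h.deliveryTime_lt hx hm).trans_le h₁).le)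
    fun m hm h => ?_
  rcases hm.eq_or_lt with rfl | hm
  · exact h₃ h
  · exact h₂.trans_le (((genTime_strictMono hx).monotone hm).trans (genTime_le_deliveryTime hs m))

lemma lastGenTime_after_delivery (hx : ∀ n, 0 < x n) (hs : ∀ n, 0 ≤ s n) {n : ℕ} {t : ℝ}
    (h : Successful x s c i n) (h₁ : deliveryTime x s n ≤ t) (h₂ : t < genTime x (n + 1)) :
    lastGenTime x s c u₀ i t = genTime x n := by
  rw [← timeStamp_succ_of_successful (u₀ := u₀) h]
  refine lastGenTime_eq_timeStamp (fun m hm h' => ?_) fun m hm h' => ?_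
  · rcases (Nat.lt_succ_iff.1 hm).eq_or_lt with rfl | hm
    · exact h₁
    · exact ((h'.deliveryTime_lt hx hm).trans_le ((genTime_le_deliveryTime hs n).trans h₁)).le
  · exact h₂.trans_le (((genTime_strictMono hx).monotone hm).trans (genTime_le_deliveryTime hs m))

lemma lastGenTime_of_lt (hx : ∀ n, 0 < x n) (hs : ∀ n, 0 ≤ s n) {t : ℝ} (h : t < genTime x 0) :
    lastGenTime x s c u₀ i t = u₀ :=
  lastGenTime_eq_timeStamp (n := 0) (by simp) fun m hm _ =>
    h.trans_le (((genTime_strictMono hx).monotone hm).trans (genTime_le_deliveryTime hs m))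

/-- Earlier successes are delivered strictly before this delivery, so the time stamp is constant
just to its left. If `s n = 0`, that left neighbourhood precedes `genTime x n`, hence
`lastGenTime_before_delivery` does not suffice. -/
lemma leftLim_age (hx : ∀ n, 0 < x n) (hs : ∀ n, 0 ≤ s n) {n : ℕ} (h : Successful x s c i n) :
    Function.leftLim (age x s c u₀ i) (deliveryTime x s n) =
      ageAt x s c u₀ i n + s n := by
  have hev : ∀ᶠ t in 𝓝[<] deliveryTime x s n,
      age x s c u₀ i t = t - timeStamp x s c u₀ i n := by
    have h₁ : ∀ᶠ t in 𝓝[<] deliveryTime x s n, ∀ m ∈ Finset.range n,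
        Successful x s c i m → deliveryTime x s m ≤ t := by
      rw [Finset.eventually_all]
      intro m hm
      by_cases hsm : Successful x s c i m
      · have : deliveryTime x s m < deliveryTime x s n :=
          (hsm.deliveryTime_lt hx (Finset.mem_range.1 hm)).trans_le (genTime_le_deliveryTime hs n)
        filter_upwards [mem_nhdsWithin_of_mem_nhds (lt_mem_nhds this)] with t ht _ using ht.le
      · exact Eventually.of_forall fun t h => absurd h hsm
    filter_upwards [h₁, self_mem_nhdsWithin] with t ht₁ ht₂
    rw [age, lastGenTime_eq_timeStamp (fun m hm => ht₁ m (Finset.mem_range.2 hm)) fun m hm hsm => ?_]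
    refine lt_of_lt_of_le ht₂ ?_
    rcases hm.eq_or_lt with rfl | hm
    · exact le_rfl
    · exact (h.deliveryTime_lt hx hm).le.trans (genTime_le_deliveryTime hs m)
  refine leftLim_eq_of_tendsto ?_
  have : ageAt x s c u₀ i n + s n = deliveryTime x s n - timeStamp x s c u₀ i n := by
    unfold ageAt deliveryTime; ring
  rw [this]
  refine Tendsto.congr' (EventuallyEq.symm hev) ?_
  exact ((continuous_id.sub continuous_const).tendsto _).mono_left nhdsWithin_le_nhds

lemma intervalIntegral_of_eq_sub {f : ℝ → ℝ} {a b v : ℝ} (hab : a ≤ b)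
    (hf : ∀ t, a ≤ t → t < b → f t = t - v) :
    IntervalIntegrable f volume a b ∧ ∫ t in a..b, f t = ((b - v) ^ 2 - (a - v) ^ 2) / 2 := by
  have h : f =ᵐ[volume.restrict (Set.uIoc a b)] fun t => t - v := by
    rw [Set.uIoc_of_le hab]
    have : ∀ᵐ t ∂(volume : Measure ℝ), t ≠ b := by simp [ae_iff]
    filter_upwards [ae_restrict_mem measurableSet_Ioc, ae_restrict_of_ae this] with t ht htb
    exact hf t ht.1.le (lt_of_le_of_ne ht.2 htb)
  have hint : IntervalIntegrable (fun t => t - v) volume a b :=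
    (continuous_id.sub continuous_const).intervalIntegrable _ _
  refine ⟨hint.congr_ae h.symm, ?_⟩
  rw [intervalIntegral.integral_congr_ae_restrict h,
    intervalIntegral.integral_sub intervalIntegral.intervalIntegrable_id (by simp)]
  simp only [integral_id, intervalIntegral.integral_const, smul_eq_mul]
  ring

/-- The age grows with slope one. A delivery lowers it by exactly `ageAt`, because it replaces the
old time stamp by `genTime x n`, and this reduction lasts for the remaining time `x (n + 1) - s n`.
-/
lemma integral_age_step (hx : ∀ n, 0 < x n) (hs : ∀ n, 0 ≤ s n) (n : ℕ) :
    IntervalIntegrable (age x s c u₀ i) volume (genTime x n) (genTime x (n + 1)) ∧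
    ∫ t in genTime x n..genTime x (n + 1), age x s c u₀ i t = ageArea x s c u₀ i n := by
  have hle := (genTime_strictMono hx).monotone n.le_succ
  by_cases h : Successful x s c i n
  · have h₁ := intervalIntegral_of_eq_sub (f := age x s c u₀ i) (genTime_le_deliveryTime hs n)
      (fun t h1 h2 => by
        rw [age, lastGenTime_before_delivery hx hs h1 (h2.trans h.2) fun _ => h2])
    have h₂ := intervalIntegral_of_eq_sub (f := age x s c u₀ i) h.2.le
      (fun t h1 h2 => by rw [age, lastGenTime_after_delivery hx hs h h1 h2])
    refine ⟨h₁.1.trans h₂.1, ?_⟩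
    rw [← intervalIntegral.integral_add_adjacent_intervals h₁.1 h₂.1, h₁.2, h₂.2, ageArea,
      if_pos h, ageAt, deliveryTime, genTime_succ]
    ring
  · have h₁ := intervalIntegral_of_eq_sub (f := age x s c u₀ i) hle
      (fun t h1 h2 => by rw [age, lastGenTime_before_delivery hx hs h1 h2 fun h' => absurd h' h])
    refine ⟨h₁.1, ?_⟩
    rw [h₁.2, ageArea, if_neg h, ageAt, genTime_succ]
    ring

lemma integral_age_genTime (hx : ∀ n, 0 < x n) (hs : ∀ n, 0 ≤ s n) (n : ℕ) :
    IntervalIntegrable (age x s c u₀ i) volume 0 (genTime x n) ∧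
    ∫ t in 0..genTime x n, age x s c u₀ i t =
      (∫ t in 0..genTime x 0, age x s c u₀ i t) +
        ∑ k ∈ Finset.range n, ageArea x s c u₀ i k := by
  induction n with
  | zero =>
    have h0 : 0 ≤ genTime x 0 := by rw [genTime_zero]; exact (hx 0).le
    exact ⟨(intervalIntegral_of_eq_sub (f := age x s c u₀ i) h0
      fun t _ h2 => by rw [age, lastGenTime_of_lt hx hs h2]).1, by simp⟩
  | succ n ih =>
    have h := integral_age_step (c := c) (u₀ := u₀) (i := i) hx hs n
    refine ⟨ih.1.trans h.1, ?_⟩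
    rw [← intervalIntegral.integral_add_adjacent_intervals ih.1 h.1, ih.2, h.2,
      Finset.sum_range_succ]
    ring

lemma timeStamp_le_genTime (hx : ∀ n, 0 < x n) {k n : ℕ} (hk : Successful x s c i k)
    (hkn : k < n) : timeStamp x s c u₀ i n ≤ genTime x n := by
  induction n, hkn using Nat.le_induction with
  | base =>
    rw [timeStamp_succ_of_successful hk]
    exact (genTime_strictMono hx).monotone k.le_succ
  | succ n hn ih =>
    have := (genTime_strictMono hx).monotone n.le_succ
    by_cases h : Successful x s c i n
    · rwa [timeStamp_succ_of_successful h]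
    · rw [timeStamp_succ_of_not h]; exact ih.trans this

end PathLemmas

/-! ### From limits along generation times to limits in continuous time -/

/-- The index of the last term of an unbounded strictly increasing sequence which is at most `τ`. -/
lemma exists_index {t : ℕ → ℝ} (ht : StrictMono t) (ht' : Tendsto t atTop atTop) :
    ∃ N : ℝ → ℕ, Tendsto N atTop atTop ∧ ∀ τ, t 0 ≤ τ → t (N τ) ≤ τ ∧ τ < t (N τ + 1) := by
  have : ∀ τ, ∃ n, t 0 ≤ τ → t n ≤ τ ∧ τ < t (n + 1) := by
    intro τ
    have hex : ∃ n, τ < t n := (ht'.eventually_gt_atTop τ).exists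
    classical
    by_cases h0 : t 0 ≤ τ
    · have hpos : Nat.find hex ≠ 0 := fun e => by
        have := Nat.find_spec hex
        rw [e] at this
        linarith
      obtain ⟨n, hn⟩ := Nat.exists_eq_succ_of_ne_zero hpos
      refine ⟨n, fun _ => ⟨not_lt.1 (Nat.find_min hex (by omega)), ?_⟩⟩
      have := Nat.find_spec hex
      rwa [hn] at this
    · exact ⟨0, fun h => absurd h h0⟩
  choose N hN using this
  refine ⟨N, tendsto_atTop.2 fun b => ?_, hN⟩
  filter_upwards [eventually_ge_atTop (t b)] with τ hτ
  have h1 := (hN τ ((ht.monotone b.zero_le).trans hτ)).2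
  have : b < N τ + 1 := ht.lt_iff_lt.1 (hτ.trans_lt h1)
  omega

lemma tendsto_div_natCast_succ {f : ℕ → ℝ} {l : ℝ} (h : Tendsto (fun n => f n / n) atTop (𝓝 l)) :
    Tendsto (fun n : ℕ => f (n + 1) / n) atTop (𝓝 l) := by
  have h1 := h.comp (tendsto_add_atTop_nat 1)
  have h2 : Tendsto (fun n : ℕ => 1 + 1 / (n : ℝ)) atTop (𝓝 1) := by
    simpa using tendsto_const_nhds.add (tendsto_one_div_atTop_nhds_zero_nat (𝕜 := ℝ))
  have h3 := h1.mul h2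
  rw [mul_one] at h3
  refine h3.congr' ?_
  filter_upwards [eventually_gt_atTop 0] with n hn
  have : (0 : ℝ) < n := by exact_mod_cast hn
  simp only [Function.comp]
  push_cast
  field_simp

/-- Monotonicity squeezes `J τ` between its values at the neighbouring points `t (N τ)` and `t (N τ
+ 1)`, which have the same limit after division by `N τ`. -/
lemma tendsto_div_index {t : ℕ → ℝ} {N : ℝ → ℕ} (hN : Tendsto N atTop atTop)
    (hN' : ∀ τ, t 0 ≤ τ → t (N τ) ≤ τ ∧ τ < t (N τ + 1)) (ht' : Tendsto t atTop atTop)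
    {J : ℝ → ℝ} {T l : ℝ} (hJ : MonotoneOn J (Set.Ici T))
    (h : Tendsto (fun n : ℕ => J (t n) / n) atTop (𝓝 l)) :
    Tendsto (fun τ => J τ / N τ) atTop (𝓝 l) := by
  have h' : Tendsto (fun n : ℕ => J (t (n + 1)) / n) atTop (𝓝 l) :=
    tendsto_div_natCast_succ (f := fun n => J (t n)) h
  refine tendsto_of_tendsto_of_tendsto_of_le_of_le' (h.comp hN) (h'.comp hN) ?_ ?_
  all_goals
    filter_upwards [hN.eventually ((ht'.eventually_ge_atTop T)), eventually_ge_atTop (t 0)]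
      with τ h1 h2
    obtain ⟨h3, h4⟩ := hN' τ h2
    simp only [Function.comp]
    gcongr
  · exact hJ h1 (h1.trans h3) h3
  · exact hJ (h1.trans h3) (h1.trans (h3.trans h4.le)) h4.le

lemma tendsto_div_of_tendsto_div_nat {t : ℕ → ℝ} (ht : StrictMono t) {J : ℝ → ℝ} {T l m : ℝ}
    (hm : 0 < m) (hJ : MonotoneOn J (Set.Ici T))
    (h : Tendsto (fun n : ℕ => J (t n) / n) atTop (𝓝 l))
    (htm : Tendsto (fun n : ℕ => t n / n) atTop (𝓝 m)) :
    Tendsto (fun τ => 1 / τ * J τ) atTop (𝓝 (l / m)) := by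
  have ht' : Tendsto t atTop atTop := by
    refine (htm.pos_mul_atTop hm tendsto_natCast_atTop_atTop).congr' ?_
    filter_upwards [eventually_gt_atTop 0] with n hn
    have : (0 : ℝ) < n := by exact_mod_cast hn
    field_simp
  obtain ⟨N, hN, hN'⟩ := exists_index ht ht'
  have h1 := tendsto_div_index hN hN' ht' hJ h
  -- The same lemma for the identity gives `τ / N τ → m`; the count `N τ` cancels in the quotient.
  have h2 := tendsto_div_index hN hN' ht' (J := fun τ => τ) (T := 0) (fun _ _ _ _ h => h) htm
  refine (h1.div h2 hm.ne').congr' ?_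
  filter_upwards [hN.eventually_gt_atTop 0, eventually_gt_atTop 0] with τ hn hτ
  have : (0 : ℝ) < N τ := by exact_mod_cast hn
  simp only [Pi.div_apply]
  field_simp

/-! ### Time averages and peak averages on one sample path -/

section PathAverages

variable {M : ℕ} {x s : ℕ → ℝ} {c : ℕ → Fin M} {u₀ : ℝ} {i : Fin M}

lemma age_nonneg (hx : ∀ n, 0 < x n) (hs : ∀ n, 0 ≤ s n) {k n : ℕ}
    (hk : Successful x s c i k) (hkn : k < n) {t : ℝ} (h₁ : genTime x n ≤ t)
    (h₂ : t < genTime x (n + 1)) : 0 ≤ age x s c u₀ i t := by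
  have hv := timeStamp_le_genTime (u₀ := u₀) hx hk hkn
  by_cases h : Successful x s c i n ∧ deliveryTime x s n ≤ t
  · rw [age, lastGenTime_after_delivery hx hs h.1 h.2 h₂]; linarith
  · rw [age, lastGenTime_before_delivery hx hs h₁ h₂ fun h' => not_le.1 fun h'' => h ⟨h', h''⟩]
    linarith

/-- The time average of the age, from its averages between successive generations. -/
theorem tendsto_average_age (hx : ∀ n, 0 < x n) (hs : ∀ n, 0 ≤ s n) {k : ℕ}
    (hk : Successful x s c i k) {l m : ℝ} (hm : 0 < m)
    (ht : Tendsto (fun n : ℕ => genTime x n / n) atTop (𝓝 m))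
    (hl : Tendsto (fun n : ℕ => (∑ j ∈ Finset.range n, ageArea x s c u₀ i j) / n) atTop (𝓝 l)) :
    Tendsto (fun τ : ℝ => 1 / τ * ∫ t in (0 : ℝ)..τ, age x s c u₀ i t) atTop (𝓝 (l / m)) := by
  have hmono := genTime_strictMono hx
  have ht' : Tendsto (genTime x) atTop atTop := by
    refine (ht.pos_mul_atTop hm tendsto_natCast_atTop_atTop).congr' ?_
    filter_upwards [eventually_gt_atTop 0] with n hn
    have : (0 : ℝ) < n := by exact_mod_cast hn
    field_simp
  obtain ⟨N, hN, hN'⟩ := exists_index hmono ht'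
  -- As `u₀` is arbitrary, the age may be negative before the first reception; its integral is known
  -- to be monotone only from here on.
  have hnn : ∀ t, genTime x (k + 1) ≤ t → 0 ≤ age x s c u₀ i t := by
    intro t h
    obtain ⟨h1, h2⟩ := hN' t ((hmono.monotone (k + 1).zero_le).trans h)
    have : k + 1 < N t + 1 := hmono.lt_iff_lt.1 (h.trans_lt h2)
    exact age_nonneg hx hs hk (by omega) h1 h2
  have hint : ∀ τ, 0 ≤ τ → IntervalIntegrable (age x s c u₀ i) volume 0 τ := by
    intro τ hτ
    obtain ⟨n, hn⟩ := (ht'.eventually_ge_atTop τ).exists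
    refine (integral_age_genTime hx hs n).1.mono_set ?_
    rw [Set.uIcc_of_le hτ, Set.uIcc_of_le (hτ.trans hn)]
    exact Set.Icc_subset_Icc_right hn
  have hpos : 0 ≤ genTime x (k + 1) := by
    refine le_trans ?_ (hmono.monotone (k + 1).zero_le)
    rw [genTime_zero]; exact (hx 0).le
  refine tendsto_div_of_tendsto_div_nat hmono (T := genTime x (k + 1)) hm ?_ ?_ ht
  · intro a ha b hb hab
    simp only [Set.mem_Ici] at ha hb
    rw [← sub_nonneg, intervalIntegral.integral_interval_sub_left (hint _ (hpos.trans hb))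
      (hint _ (hpos.trans ha))]
    exact intervalIntegral.integral_nonneg hab fun t h => hnn t (ha.trans h.1)
  · have h0 := tendsto_const_div_atTop_nhds_zero_nat (∫ t in 0..genTime x 0, age x s c u₀ i t)
    have := h0.add hl
    rw [zero_add] at this
    refine this.congr fun n => ?_
    rw [(integral_age_genTime hx hs n).2, add_div]

open Classical in
lemma sum_ite_range_nth {p : ℕ → Prop} (hp : (Set.ofPred p).Infinite) (f : ℕ → ℝ) (N : ℕ) :
    ∑ k ∈ Finset.range (Nat.nth p N), (if p k then f k else 0) =
      ∑ j ∈ Finset.range N, f (Nat.nth p j) := by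
  rw [← Finset.sum_filter]
  induction N with
  | zero =>
    rw [Finset.sum_range_zero, Finset.filter_eq_empty_iff.2, Finset.sum_empty]
    intro n h₁ h₂
    rw [Nat.nth_zero] at h₁
    exact (Finset.mem_range.1 h₁).not_ge (Nat.sInf_le h₂)
  | succ N ih =>
    rw [Nat.filter_range_nth_eq_insert_of_infinite hp, Finset.sum_insert (by simp), ih,
      Finset.sum_range_succ, add_comm]

-- At a success, `ageAt` is the increment of the time stamp, so these increments telescope to
-- `timeStamp x s c u₀ i n - u₀`.
open Classical in
lemma sum_ageAt_add_service (n : ℕ) :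
    ∑ k ∈ Finset.range n, (if Successful x s c i k then ageAt x s c u₀ i k + s k else 0) =
      genTime x n - ageAt x s c u₀ i n - u₀ +
        ∑ k ∈ Finset.range n, (if Successful x s c i k then s k else 0) := by
  induction n with
  | zero => simp [ageAt, timeStamp]
  | succ n ih =>
    rw [Finset.sum_range_succ, ih, Finset.sum_range_succ]
    unfold ageAt
    by_cases h : Successful x s c i n
    · rw [if_pos h, if_pos h, timeStamp_succ_of_successful h]; ring
    · rw [if_neg h, if_neg h, timeStamp_succ_of_not h]; ring

lemma sum_peakAge (hx : ∀ n, 0 < x n) (hs : ∀ n, 0 ≤ s n)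
    (hinf : {n | Successful x s c i n}.Infinite) (N : ℕ) :
    ∑ j ∈ Finset.range N, peakAge x s c u₀ i j = ∑ j ∈ Finset.range N,
      (ageAt x s c u₀ i (Nat.nth (Successful x s c i) j) + s (Nat.nth (Successful x s c i) j)) :=
  Finset.sum_congr rfl fun j _ => leftLim_age hx hs (Nat.nth_mem_of_infinite hinf j)

open Classical in
lemma infinite_of_tendsto_average {p : ℕ → Prop} {q : ℝ} (hq : 0 < q)
    (h : Tendsto (fun n : ℕ => (∑ k ∈ Finset.range n, if p k then (1 : ℝ) else 0) / n) atTop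
      (𝓝 q)) : {n | p n}.Infinite := by
  intro hfin
  have h0 : Tendsto (fun k => if p k then (1 : ℝ) else 0) atTop (𝓝 0) := by
    refine tendsto_const_nhds.congr' ?_
    obtain ⟨B, hB⟩ := hfin.bddAbove
    filter_upwards [eventually_gt_atTop B] with n hn
    have hnp : ¬ p n := fun h => absurd (hB h) (not_le.2 hn)
    rw [if_neg hnp]
  have h1 := h0.cesaro
  refine hq.ne' (tendsto_nhds_unique h (h1.congr fun n => ?_))
  rw [div_eq_inv_mul]

open Classical in
/-- The average of the peak ages, from averages over all updates. -/
theorem tendsto_average_peakAge (hx : ∀ n, 0 < x n) (hs : ∀ n, 0 ≤ s n) {m q b : ℝ} (hq : 0 < q)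
    (ht : Tendsto (fun n : ℕ => genTime x n / n) atTop (𝓝 m))
    (ha : Tendsto (fun n : ℕ => ageAt x s c u₀ i n / n) atTop (𝓝 0))
    (hc : Tendsto (fun n : ℕ =>
      (∑ k ∈ Finset.range n, if Successful x s c i k then (1 : ℝ) else 0) / n) atTop (𝓝 q))
    (hb : Tendsto (fun n : ℕ =>
      (∑ k ∈ Finset.range n, if Successful x s c i k then s k else 0) / n) atTop (𝓝 b)) :
    Tendsto (fun N : ℕ => 1 / (N : ℝ) * ∑ j ∈ Finset.range N, peakAge x s c u₀ i j) atTop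
      (𝓝 ((m + b) / q)) := by
  have hinf := infinite_of_tendsto_average hq hc
  have hnth : Tendsto (Nat.nth (Successful x s c i)) atTop atTop :=
    (Nat.nth_strictMono hinf).tendsto_atTop
  have h1 := ((ht.sub ha).sub (tendsto_const_div_atTop_nhds_zero_nat u₀)).add hb
  rw [sub_zero, sub_zero] at h1
  -- The quotient of two averages over all updates, read at the index of success number `N` (from
  -- `0`), is an average over the first `N` successes.
  have h2 := (h1.div hc hq.ne').comp hnth
  refine h2.congr' ?_
  filter_upwards [hnth.eventually_gt_atTop 0] with N hN
  have hpos : (0 : ℝ) < (Nat.nth (Successful x s c i) N : ℝ) := by exact_mod_cast hN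
  have e1 := sum_ite_range_nth hinf (fun _ => (1 : ℝ)) N
  have e2 := sum_ite_range_nth hinf (fun k => ageAt x s c u₀ i k + s k) N
  simp only [Finset.sum_const, Finset.card_range, nsmul_eq_mul, mul_one] at e1
  rw [sum_peakAge hx hs hinf, ← e2, sum_ageAt_add_service]
  simp only [Function.comp, Pi.div_apply]
  rw [e1]
  rw [← sub_div, ← sub_div, ← add_div, div_div_div_cancel_right₀ hpos.ne']
  ring

end PathAverages

/-! ### Kronecker's lemma -/

section Kronecker

/-- **Kronecker's lemma** for the weights `1 / (k + 1)`. -/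
lemma tendsto_average_of_tendsto_sum_div {u : ℕ → ℝ} {l : ℝ}
    (h : Tendsto (fun n : ℕ => ∑ k ∈ Finset.range n, u k / (k + 1)) atTop (𝓝 l)) :
    Tendsto (fun n : ℕ => (∑ k ∈ Finset.range n, u k) / n) atTop (𝓝 0) := by
  set m : ℕ → ℝ := fun n => ∑ k ∈ Finset.range n, u k / (k + 1) with hm
  -- Summation by parts: the average of `u` is `m n` minus the Cesàro mean of `m`, and both tend to
  -- `l`.
  have hsum : ∀ n : ℕ, ∑ k ∈ Finset.range n, u k = n * m n - ∑ k ∈ Finset.range n, m k := by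
    intro n
    induction n with
    | zero => simp
    | succ n ih =>
      have : m (n + 1) = m n + u n / (n + 1) := by simp [hm, Finset.sum_range_succ]
      rw [Finset.sum_range_succ, Finset.sum_range_succ, ih, this]
      push_cast
      field_simp
      ring
  have h1 := h.sub h.cesaro
  rw [sub_self] at h1
  refine h1.congr' ?_
  filter_upwards [eventually_gt_atTop 0] with n hn
  have : (0 : ℝ) < n := by exact_mod_cast hn
  rw [hsum]
  field_simp

lemma tendsto_average_of_eventually_zero {u : ℕ → ℝ} (h : ∀ᶠ k in atTop, u k = 0) :
    Tendsto (fun n : ℕ => (∑ k ∈ Finset.range n, u k) / n) atTop (𝓝 0) := by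
  have h0 : Tendsto u atTop (𝓝 0) :=
    tendsto_const_nhds.congr' (by filter_upwards [h] with k hk using hk.symm)
  exact h0.cesaro.congr fun n => by rw [div_eq_inv_mul]

end Kronecker

/-! ### A strong law for martingale transforms -/

section MartingaleTransform

variable {Ω : Type*} {m0 : MeasurableSpace Ω} {P : Measure Ω}
  {ℱ : Filtration ℕ m0} {a ξ : ℕ → Ω → ℝ} {C D : ℝ}

lemma indepFun_of_indep {m : MeasurableSpace Ω} {f g : Ω → ℝ} (hf : StronglyMeasurable[m] f)
    (h : Indep (MeasurableSpace.comap g inferInstance) m P) : IndepFun f g P :=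
  (IndepFun_iff_Indep _ _ _).2 (indep_of_indep_of_le_left h.symm hf.measurable.comap_le)

lemma IndepFun.memLp_two_mul {f g : Ω → ℝ} (h : IndepFun f g P) (hf : MemLp f 2 P)
    (hg : MemLp g 2 P) : MemLp (fun ω => f ω * g ω) 2 P ∧
      ∫ ω, (f ω * g ω) ^ 2 ∂P = (∫ ω, f ω ^ 2 ∂P) * ∫ ω, g ω ^ 2 ∂P := by
  have h2 : IndepFun (fun ω => f ω ^ 2) (fun ω => g ω ^ 2) P :=
    h.comp (φ := fun x => x ^ 2) (ψ := fun x => x ^ 2) (by fun_prop) (by fun_prop)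
  have hm : AEStronglyMeasurable (fun ω => f ω * g ω) P :=
    hf.aestronglyMeasurable.mul hg.aestronglyMeasurable
  constructor
  · rw [memLp_two_iff_integrable_sq hm]
    simp only [mul_pow]
    exact h2.integrable_mul hf.integrable_sq hg.integrable_sq
  · simp only [mul_pow]
    exact h2.integral_fun_mul_eq_mul_integral hf.integrable_sq.aestronglyMeasurable
      hg.integrable_sq.aestronglyMeasurable

/-- Strong law of large numbers for a martingale transform: the average of the products of
previsible terms `a k` with bounded second moments and of centred independent innovations `ξ k`
tends to `0`. -/
theorem ae_tendsto_average_mul_innovation [IsProbabilityMeasure P]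
    (ha : ∀ n, StronglyMeasurable[ℱ n] (a n))
    (haL : ∀ n, MemLp (a n) 2 P) (hC : ∀ n, ∫ ω, a n ω ^ 2 ∂P ≤ C)
    (hξ : ∀ n, StronglyMeasurable[ℱ (n + 1)] (ξ n)) (hξL : ∀ n, MemLp (ξ n) 2 P)
    (hD : ∀ n, ∫ ω, ξ n ω ^ 2 ∂P ≤ D) (h0 : ∀ n, ∫ ω, ξ n ω ∂P = 0)
    (hind : ∀ n, Indep (MeasurableSpace.comap (ξ n) inferInstance) (ℱ n) P) :
    ∀ᵐ ω ∂P, Tendsto (fun n : ℕ => (∑ k ∈ Finset.range n, a k ω * ξ k ω) / n) atTop (𝓝 0) := by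
  -- The weights `1 / (k + 1)` are those of Kronecker's lemma, and their squares are summable, so
  -- the martingale `M` is bounded in `L²`.
  set w : ℕ → Ω → ℝ := fun k ω => a k ω * ξ k ω / (k + 1) with hw
  set M : ℕ → Ω → ℝ := fun n ω => ∑ k ∈ Finset.range n, w k ω with hM
  have hMsucc : ∀ n, M (n + 1) = fun ω => M n ω + w n ω := fun n => by
    ext ω; simp [hM, Finset.sum_range_succ]
  have hprod : ∀ n, MemLp (fun ω => a n ω * ξ n ω) 2 P ∧
      ∫ ω, (a n ω * ξ n ω) ^ 2 ∂P = (∫ ω, a n ω ^ 2 ∂P) * ∫ ω, ξ n ω ^ 2 ∂P := fun n =>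
    IndepFun.memLp_two_mul (indepFun_of_indep (ha n) (hind n)) (haL n) (hξL n)
  have hwL : ∀ n, MemLp (w n) 2 P := fun n => by
    simp only [hw, div_eq_mul_inv]
    exact (hprod n).1.mul_const _
  have hML : ∀ n, MemLp (M n) 2 P := fun n => by
    simpa [hM] using! memLp_finsetSum (Finset.range n) fun k _ => hwL k
  have hMm : ∀ n, StronglyMeasurable[ℱ n] (M n) := fun n => by
    refine Finset.stronglyMeasurable_fun_sum _ fun k hk => ?_
    have hk' : k + 1 ≤ n := Finset.mem_range.1 hk
    have h1 : StronglyMeasurable[ℱ n] (a k) := (ha k).mono (ℱ.mono (by omega))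
    have h2 : StronglyMeasurable[ℱ n] (ξ k) := (hξ k).mono (ℱ.mono hk')
    simp only [hw, div_eq_mul_inv]
    exact (h1.mul h2).mul stronglyMeasurable_const
  have hmart : Martingale M ℱ P := by
    refine martingale_of_condExp_sub_eq_zero_nat hMm (fun n => (hML n).integrable one_le_two)
      fun n => ?_
    have e : M (n + 1) - M n = (fun ω => a n ω / (n + 1)) * ξ n := by
      ext ω; simp [hMsucc, hw]; ring
    rw [e]
    have h1 : StronglyMeasurable[ℱ n] fun ω => a n ω / (n + 1) := by
      simp only [div_eq_mul_inv]
      exact (ha n).mul stronglyMeasurable_const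
    have h2 := condExp_mul_of_stronglyMeasurable_left h1 (μ := P) (g := ξ n)
      (by rw [← e]; exact ((hML _).sub (hML _)).integrable one_le_two)
      ((hξL n).integrable one_le_two)
    have h3 : P[ξ n | ℱ n] =ᵐ[P] fun _ => P[ξ n] :=
      condExp_indep_eq ((hξ n).mono (ℱ.le _)).measurable.comap_le (ℱ.le n)
        (comap_measurable (ξ n)).stronglyMeasurable (hind n)
    filter_upwards [h2, h3] with ω e2 e3
    rw [e2, Pi.mul_apply, e3, h0 n, mul_zero, Pi.zero_apply]
  have hC0 : 0 ≤ C := (integral_nonneg fun ω => sq_nonneg (a 0 ω)).trans (hC 0)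
  have hsummable : Summable fun k : ℕ => 1 / ((k : ℝ) + 1) ^ 2 := by
    have := (summable_nat_add_iff 1).2 (Real.summable_one_div_nat_pow.2 one_lt_two)
    simpa using this
  have hsq : ∀ n, ∫ ω, M n ω ^ 2 ∂P ≤ ∑ k ∈ Finset.range n, C * D * (1 / ((k : ℝ) + 1) ^ 2) := by
    intro n
    induction n with
    | zero => simp [hM]
    | succ n ih =>
      have hMa : IndepFun (fun ω => M n ω * a n ω) (ξ n) P :=
        indepFun_of_indep ((hMm n).mul (ha n)) (hind n)
      have hMai : Integrable (fun ω => M n ω * a n ω) P := (hML n).integrable_mul (haL n)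
      -- The increments are orthogonal: `M n * a n` belongs to the past, and `ξ n` is centred and
      -- independent of the past.
      have hcross : ∫ ω, M n ω * w n ω ∂P = 0 := by
        have : ∀ ω, M n ω * w n ω = (M n ω * a n ω * ξ n ω) / (n + 1) := fun ω => by
          simp only [hw]; ring
        simp_rw [this]
        rw [integral_div, hMa.integral_fun_mul_eq_mul_integral hMai.aestronglyMeasurable
          (hξL n).aestronglyMeasurable, h0, mul_zero, zero_div]
      have hsq' : ∫ ω, w n ω ^ 2 ∂P ≤ C * D * (1 / ((n : ℝ) + 1) ^ 2) := by
        simp only [hw, div_pow]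
        rw [integral_div, (hprod n).2, mul_one_div]
        have : (∫ ω, a n ω ^ 2 ∂P) * ∫ ω, ξ n ω ^ 2 ∂P ≤ C * D :=
          mul_le_mul (hC n) (hD n) (integral_nonneg fun ω => sq_nonneg (ξ n ω)) hC0
        gcongr
      have hexp : ∀ ω, M (n + 1) ω ^ 2 = M n ω ^ 2 + 2 * (M n ω * w n ω) + w n ω ^ 2 := fun ω => by
        rw [hMsucc]; ring
      have hi1 := (hML n).integrable_sq
      have hi2 : Integrable (fun ω => 2 * (M n ω * w n ω)) P :=
        ((hML n).integrable_mul (hwL n)).const_mul 2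
      simp_rw [hexp]
      rw [integral_add (f := fun ω => M n ω ^ 2 + 2 * (M n ω * w n ω)) (hi1.add hi2)
          (hwL n).integrable_sq, integral_add hi1 hi2,
        integral_const_mul, hcross, Finset.sum_range_succ]
      linarith
  set K : ℝ := ∑' k : ℕ, C * D * (1 / ((k : ℝ) + 1) ^ 2)
  have hD0 : 0 ≤ D := (integral_nonneg fun ω => sq_nonneg (ξ 0 ω)).trans (hD 0)
  have hbdd : ∀ n, eLpNorm (M n) 1 P ≤ ((1 + K).toNNReal : ENNReal) := by
    intro n
    have hMi := (hML n).integrable one_le_two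
    rw [eLpNorm_one_eq_lintegral_enorm, ← ofReal_integral_norm_eq_lintegral_enorm hMi]
    refine ENNReal.ofReal_le_ofReal ?_
    -- The convergence theorem asks for an `L¹` bound, which follows from the `L²` bound by `|x| ≤ 1
    -- + x ^ 2`.
    have h1 : ∫ ω, ‖M n ω‖ ∂P ≤ ∫ ω, (1 + M n ω ^ 2) ∂P := by
      refine integral_mono hMi.norm ((integrable_const 1).add (hML n).integrable_sq) fun ω => ?_
      rw [Real.norm_eq_abs]
      nlinarith [sq_abs (M n ω), sq_nonneg (|M n ω| - 1)]
    rw [integral_add (integrable_const 1) (hML n).integrable_sq] at h1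
    have h2 := (hsummable.mul_left (C * D)).sum_le_tsum (Finset.range n)
      fun k _ => by positivity
    simp only [integral_const, probReal_univ, smul_eq_mul, one_mul] at h1
    linarith [hsq n]
  filter_upwards [hmart.submartingale.exists_ae_tendsto_of_bdd hbdd] with ω ⟨l, hl⟩
  exact tendsto_average_of_tendsto_sum_div hl

/-- The series of the squares `(a n / n) ^ 2` has finite expectation, so it converges almost surely
and its terms vanish in the limit. -/
lemma ae_tendsto_div_of_integral_sq_le (haL : ∀ n, MemLp (a n) 2 P)
    (hC : ∀ n, ∫ ω, a n ω ^ 2 ∂P ≤ C) :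
    ∀ᵐ ω ∂P, Tendsto (fun n : ℕ => a n ω / n) atTop (𝓝 0) := by
  have hterm : ∀ n : ℕ, ∫⁻ ω, ENNReal.ofReal ((a n ω / n) ^ 2) ∂P ≤
      ENNReal.ofReal (C * (1 / (n : ℝ) ^ 2)) := by
    intro n
    simp only [div_pow]
    rw [← ofReal_integral_eq_lintegral_ofReal ((haL n).integrable_sq.div_const _)
      (ae_of_all _ fun ω => by positivity), integral_div, mul_one_div]
    gcongr
    exact hC n
  have hC0 : 0 ≤ C := (integral_nonneg fun ω => sq_nonneg (a 0 ω)).trans (hC 0)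
  have hfin : ∫⁻ ω, ∑' n : ℕ, ENNReal.ofReal ((a n ω / n) ^ 2) ∂P ≠ ⊤ := by
    rw [lintegral_tsum fun n =>
      (((haL n).aestronglyMeasurable.aemeasurable.div_const _).pow_const 2).ennreal_ofReal]
    refine ne_top_of_le_ne_top ?_ (ENNReal.tsum_le_tsum hterm)
    have hs : Summable fun n : ℕ => C * (1 / (n : ℝ) ^ 2) :=
      (Real.summable_one_div_nat_pow.2 one_lt_two).mul_left C
    rw [← ENNReal.ofReal_tsum_of_nonneg (fun n => by positivity) hs]
    exact ENNReal.ofReal_ne_top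
  have hmeas : AEMeasurable (fun ω => ∑' n : ℕ, ENNReal.ofReal ((a n ω / n) ^ 2)) P :=
    AEMeasurable.tsum fun n =>
      (((haL n).aestronglyMeasurable.aemeasurable.div_const _).pow_const 2).ennreal_ofReal
  filter_upwards [ae_lt_top' hmeas hfin] with ω hω
  have h1 := ENNReal.tendsto_atTop_zero_of_tsum_ne_top hω.ne
  have h2 := (ENNReal.continuousAt_toReal ENNReal.zero_ne_top).tendsto.comp h1
  have h3 : Tendsto (fun n : ℕ => (a n ω / n) ^ 2) atTop (𝓝 0) := by
    refine h2.congr fun n => ?_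
    simp only [Function.comp]
    rw [ENNReal.toReal_ofReal (sq_nonneg _)]
  have h4 := h3.sqrt
  rw [Real.sqrt_zero] at h4
  refine tendsto_zero_iff_abs_tendsto_zero _ |>.2 (h4.congr fun n => ?_)
  simp [Real.sqrt_sq_eq_abs]

end MartingaleTransform

/-! ### The reset chain driven by an i.i.d. sequence -/

section Chain

variable {Ω E : Type*} {m0 : MeasurableSpace Ω} {mE : MeasurableSpace E} {P : Measure Ω}
  {μ : Measure E} {Y : ℕ → Ω → E} {χ f ξ : E → ℝ}

/-- The process which starts from `0` and is reset by `χ (Y n) = 1` before it grows by `f (Y n)`. -/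
def chain (χ f : E → ℝ) (Y : ℕ → Ω → E) : ℕ → Ω → ℝ
  | 0 => fun _ => 0
  | n + 1 => fun ω => (1 - χ (Y n ω)) * chain χ f Y n ω + f (Y n ω)

/-- The information in the terms of `Y` before the `n`-th one. -/
def pastFiltration (Y : ℕ → Ω → E) (hY : ∀ n, Measurable (Y n)) : Filtration ℕ m0 where
  seq n := ⨆ k ∈ Set.Iio n, MeasurableSpace.comap (Y k) mE
  mono' _ _ hij := biSup_mono fun _ hk => lt_of_lt_of_le hk hij
  le' _ := iSup₂_le fun k _ => (hY k).comap_le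

lemma measurable_pastFiltration (hY : ∀ n, Measurable (Y n)) {k n : ℕ} (hkn : k < n) :
    Measurable[pastFiltration Y hY n] (Y k) :=
  Measurable.of_comap_le (le_biSup (fun k => MeasurableSpace.comap (Y k) mE) (Set.mem_Iio.2 hkn))

lemma indep_pastFiltration (hY : ∀ n, Measurable (Y n)) (hind : iIndepFun Y P) (n : ℕ)
    (hξ : Measurable ξ) :
    Indep (MeasurableSpace.comap (fun ω => ξ (Y n ω)) inferInstance) (pastFiltration Y hY n) P := by
  have h := indep_iSup_of_disjoint (fun k => (hY k).comap_le) hind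
    (S := {n}) (T := Set.Iio n) (by simp)
  refine indep_of_indep_of_le_left h ?_
  rw [iSup_singleton]
  exact (hξ.comp (comap_measurable (Y n))).comap_le

/-- The `n`-th state uses only the terms `Y k` with `k < n`, and is therefore independent of `Y n`.
-/
lemma stronglyMeasurable_chain (hY : ∀ n, Measurable (Y n)) (hχ : Measurable χ)
    (hf : Measurable f) (n : ℕ) :
    StronglyMeasurable[pastFiltration Y hY n] (chain χ f Y n) := by
  induction n with
  | zero => exact stronglyMeasurable_const
  | succ n ih =>
    have h1 : StronglyMeasurable[pastFiltration Y hY (n + 1)] (chain χ f Y n) :=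
      ih.mono ((pastFiltration Y hY).mono n.le_succ)
    have h2 := measurable_pastFiltration hY n.lt_succ_self
    have h3 : StronglyMeasurable[pastFiltration Y hY (n + 1)] fun ω => 1 - χ (Y n ω) :=
      (measurable_const.sub (hχ.comp h2)).stronglyMeasurable
    exact (h3.mul h1).add (hf.comp h2).stronglyMeasurable

lemma integral_comp_law (hY : ∀ n, Measurable (Y n)) (hlaw : ∀ n, P.map (Y n) = μ) (n : ℕ)
    {φ : E → ℝ} (hφ : Measurable φ) : ∫ ω, φ (Y n ω) ∂P = ∫ y, φ y ∂μ := by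
  rw [← hlaw n, integral_map (hY n).aemeasurable hφ.aestronglyMeasurable]

lemma memLp_comp_law (hY : ∀ n, Measurable (Y n)) (hlaw : ∀ n, P.map (Y n) = μ) (n : ℕ)
    {φ : E → ℝ} (hφ : MemLp φ 2 μ) : MemLp (fun ω => φ (Y n ω)) 2 P := by
  rw [← hlaw n] at hφ
  exact hφ.comp_of_map (hY n).aemeasurable

/-- The strong law of large numbers for functions of the terms of an i.i.d. sequence. -/
lemma ae_tendsto_average (hY : ∀ n, Measurable (Y n)) (hind : iIndepFun Y P)
    (hlaw : ∀ n, P.map (Y n) = μ) {φ : E → ℝ} (hφ : Measurable φ) (hi : Integrable φ μ) :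
    ∀ᵐ ω ∂P, Tendsto (fun n : ℕ => (∑ k ∈ Finset.range n, φ (Y k ω)) / n) atTop
      (𝓝 (∫ y, φ y ∂μ)) := by
  rw [← integral_comp_law hY hlaw 0 hφ]
  refine strong_law_ae_real (fun n ω => φ (Y n ω)) ?_ (fun i j hij => ?_) fun i => ?_
  · rw [← hlaw 0] at hi
    exact hi.comp_measurable (hY 0)
  · exact (hind.indepFun hij).comp hφ hφ
  · exact (IdentDistrib.mk (hY i).aemeasurable (hY 0).aemeasurable
      ((hlaw i).trans (hlaw 0).symm)).comp hφ

lemma chain_memLp (hY : ∀ n, Measurable (Y n))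
    (hlaw : ∀ n, P.map (Y n) = μ) (hχ : Measurable χ) (hχ01 : ∀ y, χ y = 0 ∨ χ y = 1)
    (hfL : MemLp f 2 μ) (n : ℕ) : MemLp (chain χ f Y n) 2 P := by
  induction n with
  | zero => exact MemLp.zero'
  | succ n ih =>
    have h1 : MemLp (fun ω => (1 - χ (Y n ω)) * chain χ f Y n ω) 2 P := by
      refine ih.mono ?_ (ae_of_all _ fun ω => ?_)
      · exact (measurable_const.sub (hχ.comp (hY n))).aestronglyMeasurable.mul
          ih.aestronglyMeasurable
      · rcases hχ01 (Y n ω) with h | h <;> simp [h]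
    exact h1.add (memLp_comp_law hY hlaw n hfL)

/-- Young's inequality `(a + f) ^ 2 ≤ (1 + π) * a ^ 2 + (1 + 1 / π) * f ^ 2`, together with the
survival probability `1 - π`, contracts the second moment by `(1 + π) * (1 - π) = 1 - π ^ 2`. The
bound is the fixed point of the resulting affine recursion. -/
lemma integral_chain_sq_le [IsProbabilityMeasure P]
    (hY : ∀ n, Measurable (Y n)) (hind : iIndepFun Y P)
    (hlaw : ∀ n, P.map (Y n) = μ) (hχ : Measurable χ) (hχ01 : ∀ y, χ y = 0 ∨ χ y = 1)
    (hχpos : 0 < ∫ y, χ y ∂μ) (hf : Measurable f) (hfL : MemLp f 2 μ) (n : ℕ) :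
    ∫ ω, chain χ f Y n ω ^ 2 ∂P ≤
      (1 + 1 / ∫ y, χ y ∂μ) * (∫ y, f y ^ 2 ∂μ) / (∫ y, χ y ∂μ) ^ 2 := by
  set π := ∫ y, χ y ∂μ with hπ
  have hprob : IsProbabilityMeasure μ := by
    rw [← hlaw 0]; exact Measure.isProbabilityMeasure_map (hY 0).aemeasurable
  have hχi : Integrable χ μ := Integrable.of_bound hχ.aestronglyMeasurable 1
    (ae_of_all _ fun y => by rcases hχ01 y with h | h <;> simp [h])
  have hπ1 : π ≤ 1 := by
    have : π ≤ ∫ _, (1 : ℝ) ∂μ := integral_mono hχi (integrable_const 1) fun y => by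
      rcases hχ01 y with h | h <;> simp [h]
    simpa using this
  have hF : 0 ≤ ∫ y, f y ^ 2 ∂μ := integral_nonneg fun y => sq_nonneg (f y)
  induction n with
  | zero =>
    simp only [chain]
    simp only [ne_eq, OfNat.ofNat_ne_zero, not_false_eq_true, zero_pow, integral_zero]
    positivity
  | succ n ih =>
    have haL := chain_memLp hY hlaw hχ hχ01 hfL n
    have hind' : IndepFun (fun ω => chain χ f Y n ω ^ 2) (fun ω => 1 - χ (Y n ω)) P :=
      indepFun_of_indep (((stronglyMeasurable_chain hY hχ hf n).pow 2))
        (indep_pastFiltration hY hind n (measurable_const.sub hχ))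
    have hχn : Integrable (fun ω => χ (Y n ω)) P := by
      rw [← hlaw n] at hχi
      exact hχi.comp_measurable (hY n)
    have hi : Integrable (fun ω => 1 - χ (Y n ω)) P := (integrable_const 1).sub hχn
    have h1 : ∫ ω, chain χ f Y n ω ^ 2 * (1 - χ (Y n ω)) ∂P =
        (∫ ω, chain χ f Y n ω ^ 2 ∂P) * (1 - π) := by
      rw [hind'.integral_fun_mul_eq_mul_integral haL.integrable_sq.aestronglyMeasurable
        hi.aestronglyMeasurable, integral_sub (integrable_const 1) hχn,
        integral_comp_law hY hlaw n hχ]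
      simp [hπ]
    have hi1 : Integrable (fun ω => chain χ f Y n ω ^ 2 * (1 - χ (Y n ω))) P :=
      hind'.integrable_mul haL.integrable_sq hi
    have hi2 : Integrable (fun ω => f (Y n ω) ^ 2) P :=
      (memLp_comp_law hY hlaw n hfL).integrable_sq
    have h2 : ∫ ω, chain χ f Y (n + 1) ω ^ 2 ∂P ≤
        ∫ ω, ((1 + π) * (chain χ f Y n ω ^ 2 * (1 - χ (Y n ω))) +
          (1 + 1 / π) * f (Y n ω) ^ 2) ∂P := by
      refine integral_mono (chain_memLp hY hlaw hχ hχ01 hfL (n + 1)).integrable_sq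
        ((hi1.const_mul _).add (hi2.const_mul _)) fun ω => ?_
      simp only [chain]
      rcases hχ01 (Y n ω) with h | h
      · rw [h]
        have : (1 + π) * (chain χ f Y n ω ^ 2 * (1 - 0)) + (1 + 1 / π) * f (Y n ω) ^ 2 -
            ((1 - 0) * chain χ f Y n ω + f (Y n ω)) ^ 2 =
            π * (chain χ f Y n ω - f (Y n ω) / π) ^ 2 := by
          field_simp
          ring
        have h' : 0 ≤ π * (chain χ f Y n ω - f (Y n ω) / π) ^ 2 := by positivity
        linarith
      · rw [h]
        have : 0 ≤ 1 / π * f (Y n ω) ^ 2 := by positivity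
        nlinarith
    rw [integral_add (hi1.const_mul _) (hi2.const_mul _), integral_const_mul, integral_const_mul,
      h1, integral_comp_law hY hlaw n (φ := fun y => f y ^ 2) (hf.pow_const 2)] at h2
    refine h2.trans ?_
    set F := ∫ y, f y ^ 2 ∂μ
    have h3 : (1 + π) * ((∫ ω, chain χ f Y n ω ^ 2 ∂P) * (1 - π)) ≤
        (1 + π) * ((1 + 1 / π) * F / π ^ 2 * (1 - π)) := by
      gcongr
    refine (add_le_add_left h3 _).trans (le_of_eq ?_)
    field_simp
    ring

lemma chain_eq_sum (n : ℕ) (ω : Ω) : chain χ f Y n ω =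
    ∑ k ∈ Finset.range n, f (Y k ω) - ∑ k ∈ Finset.range n, chain χ f Y k ω * χ (Y k ω) := by
  induction n with
  | zero => simp [chain]
  | succ n ih =>
    rw [Finset.sum_range_succ, Finset.sum_range_succ, chain, add_sub_add_comm, ← ih]
    ring

lemma ae_tendsto_chain_div [IsProbabilityMeasure P]
    (hY : ∀ n, Measurable (Y n)) (hind : iIndepFun Y P)
    (hlaw : ∀ n, P.map (Y n) = μ) (hχ : Measurable χ) (hχ01 : ∀ y, χ y = 0 ∨ χ y = 1)
    (hχpos : 0 < ∫ y, χ y ∂μ) (hf : Measurable f) (hfL : MemLp f 2 μ) :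
    ∀ᵐ ω ∂P, Tendsto (fun n : ℕ => chain χ f Y n ω / n) atTop (𝓝 0) :=
  ae_tendsto_div_of_integral_sq_le (chain_memLp hY hlaw hχ hχ01 hfL)
    (integral_chain_sq_le hY hind hlaw hχ hχ01 hχpos hf hfL)

lemma ae_tendsto_average_chain_mul_centered [IsProbabilityMeasure P]
    (hY : ∀ n, Measurable (Y n)) (hind : iIndepFun Y P)
    (hlaw : ∀ n, P.map (Y n) = μ) (hχ : Measurable χ) (hχ01 : ∀ y, χ y = 0 ∨ χ y = 1)
    (hχpos : 0 < ∫ y, χ y ∂μ) (hf : Measurable f) (hfL : MemLp f 2 μ)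
    (hξ : Measurable ξ) (hξL : MemLp ξ 2 μ) :
    ∀ᵐ ω ∂P, Tendsto (fun n : ℕ =>
      (∑ k ∈ Finset.range n, chain χ f Y k ω * (ξ (Y k ω) - ∫ y, ξ y ∂μ)) / n) atTop (𝓝 0) := by
  have hprob : IsProbabilityMeasure μ := by
    rw [← hlaw 0]; exact Measure.isProbabilityMeasure_map (hY 0).aemeasurable
  set ζ : E → ℝ := fun y => ξ y - ∫ y, ξ y ∂μ with hζ
  have hζm : Measurable ζ := hξ.sub_const _
  have hζL : MemLp ζ 2 μ := hξL.sub (memLp_const _)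
  refine ae_tendsto_average_mul_innovation (ℱ := pastFiltration Y hY)
    (ξ := fun k ω => ζ (Y k ω)) (D := ∫ y, ζ y ^ 2 ∂μ)
    (stronglyMeasurable_chain hY hχ hf) (chain_memLp hY hlaw hχ hχ01 hfL)
    (integral_chain_sq_le hY hind hlaw hχ hχ01 hχpos hf hfL)
    (fun n => (hζm.comp (measurable_pastFiltration hY n.lt_succ_self)).stronglyMeasurable)
    (fun n => memLp_comp_law hY hlaw n hζL)
    (fun n => (integral_comp_law hY hlaw n (φ := fun y => ζ y ^ 2) (hζm.pow_const 2)).le)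
    (fun n => ?_) fun n => indep_pastFiltration hY hind n hζm
  rw [integral_comp_law hY hlaw n hζm, hζ,
    integral_sub (hξL.integrable one_le_two) (integrable_const _)]
  simp

/-- The average of the products of the states of the chain with functions of the next innovation. -/
theorem ae_tendsto_average_chain_mul [IsProbabilityMeasure P]
    (hY : ∀ n, Measurable (Y n)) (hind : iIndepFun Y P)
    (hlaw : ∀ n, P.map (Y n) = μ) (hχ : Measurable χ) (hχ01 : ∀ y, χ y = 0 ∨ χ y = 1)
    (hχpos : 0 < ∫ y, χ y ∂μ) (hf : Measurable f) (hfL : MemLp f 2 μ)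
    (hξ : Measurable ξ) (hξL : MemLp ξ 2 μ) :
    ∀ᵐ ω ∂P, Tendsto (fun n : ℕ =>
      (∑ k ∈ Finset.range n, chain χ f Y k ω * ξ (Y k ω)) / n) atTop
      (𝓝 ((∫ y, ξ y ∂μ) * ((∫ y, f y ∂μ) / ∫ y, χ y ∂μ))) := by
  have hprob : IsProbabilityMeasure μ := by
    rw [← hlaw 0]; exact Measure.isProbabilityMeasure_map (hY 0).aemeasurable
  have hχL : MemLp χ 2 μ := MemLp.of_bound hχ.aestronglyMeasurable 1
    (ae_of_all _ fun y => by rcases hχ01 y with h | h <;> simp [h])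
  filter_upwards [ae_tendsto_average_chain_mul_centered hY hind hlaw hχ hχ01 hχpos hf hfL hξ hξL,
    ae_tendsto_average_chain_mul_centered hY hind hlaw hχ hχ01 hχpos hf hfL hχ hχL,
    ae_tendsto_chain_div hY hind hlaw hχ hχ01 hχpos hf hfL,
    ae_tendsto_average hY hind hlaw hf (hfL.integrable one_le_two)] with ω h1 h2 h3 h4
  -- Balance: since `chain / n → 0`, the mean growth `∫ f` equals the mean loss through resets,
  -- which by centring is `∫ χ` times the mean of the chain.
  have h5 : Tendsto (fun n : ℕ => (∑ k ∈ Finset.range n, chain χ f Y k ω) / n) atTop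
      (𝓝 ((∫ y, f y ∂μ) / ∫ y, χ y ∂μ)) := by
    have := ((h4.sub h3).sub h2).div_const (∫ y, χ y ∂μ)
    rw [sub_zero, sub_zero] at this
    refine this.congr fun n => ?_
    rw [chain_eq_sum n ω]
    simp only [mul_sub, Finset.sum_sub_distrib, ← Finset.sum_mul]
    field_simp
    ring
  have h6 := h1.add (h5.const_mul (∫ y, ξ y ∂μ))
  rw [zero_add] at h6
  refine h6.congr fun n => ?_
  simp only [mul_sub, Finset.sum_sub_distrib, ← Finset.sum_mul]
  ring

end Chain

/-! ### Independence after shifting one component -/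

section Regrouping

variable {Ω α β γ : Type*} [MeasurableSpace Ω] {P : Measure Ω}
  [MeasurableSpace α] [MeasurableSpace β] [MeasurableSpace γ]

/-- Independence means that the joint law is an infinite product, and currying turns a product over
`ι × κ` into a product of products. -/
lemma iIndepFun_curry [IsProbabilityMeasure P] {ι κ : Type*} {W : ι × κ → Ω → γ}
    (hW : ∀ p, Measurable (W p)) (h : iIndepFun W P) :
    iIndepFun (fun (i : ι) ω (j : κ) => W (i, j) ω) P := by
  have hprob : ∀ i j, IsProbabilityMeasure (P.map (W (i, j))) := fun i j =>
    Measure.isProbabilityMeasure_map (hW _).aemeasurable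
  have hm : ∀ i : ι, Measurable fun ω (j : κ) => W (i, j) ω := fun i =>
    measurable_pi_iff.2 fun j => hW _
  have h1 : ∀ i, P.map (fun ω (j : κ) => W (i, j) ω) =
      Measure.infinitePi fun j => P.map (W (i, j)) := fun i =>
    (h.precomp (g := fun j => (i, j)) fun _ _ e => (Prod.mk.inj e).2).map_fun_eq_infinitePi_map
      fun j => hW (i, j)
  rw [iIndepFun_iff_map_fun_eq_infinitePi_map hm]
  simp_rw [h1]
  rw [← Measure.infinitePi_map_curry fun i j => P.map (W (i, j))]
  have h2 := h.map_fun_eq_infinitePi_map hW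
  have h3 : (Measure.infinitePi fun p : ι × κ => P.map (W (p.1, p.2))) =
      P.map fun ω p => W p ω := h2.symm
  rw [h3, Measure.map_map (by fun_prop) (measurable_pi_iff.2 hW)]
  rfl

lemma iIndepFun_bool [IsProbabilityMeasure P] {V : Bool → Ω → γ} (hV : ∀ b, Measurable (V b))
    (h : IndepFun (V true) (V false) P) : iIndepFun V P := by
  rw [iIndepFun_iff_map_fun_eq_pi_map fun b => (hV b).aemeasurable]
  have hprob : ∀ b, IsProbabilityMeasure (P.map (V b)) := fun b =>
    Measure.isProbabilityMeasure_map (hV b).aemeasurable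
  refine (Measure.pi_eq fun s hs => ?_).symm
  rw [Measure.map_apply (measurable_pi_iff.2 hV) (MeasurableSet.univ_pi hs), Fintype.prod_bool,
    Measure.map_apply (hV _) (hs _), Measure.map_apply (hV _) (hs _),
    ← h.measure_inter_preimage_eq_mul _ _ (hs _) (hs _)]
  congr 1
  ext ω
  simp [and_comm]

/-- If the pairs `(A n, B n)` are independent and have independent components, then so are the
pairs `(A (n + 1), B n)`. -/
theorem iIndepFun_shift [IsProbabilityMeasure P] {A : ℕ → Ω → α} {B : ℕ → Ω → β}
    (hA : ∀ n, Measurable (A n)) (hB : ∀ n, Measurable (B n))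
    (h : iIndepFun (fun n ω => (A n ω, B n ω)) P) (hAB : ∀ n, IndepFun (A n) (B n) P) :
    iIndepFun (fun n ω => (A (n + 1) ω, B n ω)) P := by
  obtain ⟨ω₀⟩ : Nonempty Ω := nonempty_of_isProbabilityMeasure P
  set a₀ := A 0 ω₀
  set b₀ := B 0 ω₀
  -- Padding with constants gives both components the same type, so that they form one independent
  -- family over `ℕ × Bool`.
  set g : Bool → α × β → α × β := fun j y => if j then (y.1, b₀) else (a₀, y.2) with hg
  have hgm : ∀ j, Measurable (g j) := by
    intro j
    cases j
    · exact measurable_const.prodMk measurable_snd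
    · exact measurable_fst.prodMk measurable_const
  set V : ℕ → Bool → Ω → α × β := fun n j ω => g j (A n ω, B n ω) with hV
  have hVm : ∀ n j, Measurable (V n j) := fun n j => (hgm j).comp ((hA n).prodMk (hB n))
  have h1 : iIndepFun (fun n ω => (V n · ω)) P :=
    h.comp (fun _ y j => g j y) fun _ => measurable_pi_iff.2 hgm
  have h2 : ∀ n, iIndepFun (V n) P := fun n => iIndepFun_bool (hVm n)
    ((hAB n).comp (φ := fun a => (a, b₀)) (ψ := fun b => (a₀, b))
      (measurable_id.prodMk measurable_const) (measurable_const.prodMk measurable_id))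
  have h3 := iIndepFun_uncurry' hVm h1 h2
  -- The shift of the first component is an injective reindexing of that family.
  have h4 := h3.precomp (g := fun p : ℕ × Bool => (if p.2 then p.1 + 1 else p.1, p.2)) (by
    rintro ⟨n, j⟩ ⟨n', j'⟩ e
    obtain ⟨e1, e2⟩ := Prod.mk.inj e
    simp only at e1 e2
    subst e2
    cases j <;> simp_all)
  have h5 := iIndepFun_curry (fun p => hVm _ _) h4
  exact h5.comp (fun _ v => ((v true).1, (v false).2)) fun _ =>
    (measurable_fst.comp (measurable_pi_apply true)).prodMk
      (measurable_snd.comp (measurable_pi_apply false))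

end Regrouping

/-! ### Moments of the exponential law -/

section Exponential

variable {r : ℝ}

lemma expMeasure_eq : expMeasure r = volume.withDensity (exponentialPDF r) := rfl

lemma measurable_exponentialPDF : Measurable (exponentialPDF r) :=
  (measurable_exponentialPDFReal r).ennreal_ofReal

lemma toReal_exponentialPDF (hr : 0 < r) {x : ℝ} (hx : 0 ≤ x) :
    (exponentialPDF r x).toReal = r * Real.exp (-(r * x)) := by
  rw [exponentialPDF_of_nonneg hx, ENNReal.toReal_ofReal (by positivity)]

lemma ae_pos_expMeasure : ∀ᵐ x ∂expMeasure r, 0 < x := by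
  rw [expMeasure_eq, ae_withDensity_iff measurable_exponentialPDF]
  have : ∀ᵐ x ∂(volume : Measure ℝ), x ≠ 0 := by simp [ae_iff]
  filter_upwards [this] with x hx h
  by_contra hneg
  exact h (exponentialPDF_of_neg (lt_of_le_of_ne (not_lt.1 hneg) hx))

/-- Integration against the exponential law of a nonnegative function supported on `(s, ∞)`, by
means of a primitive. -/
lemma integral_expMeasure_of_hasDerivAt (hr : 0 < r) {s l : ℝ} (hs : 0 ≤ s) {φ g : ℝ → ℝ}
    (hφ : ∀ x, s < x → 0 ≤ φ x)
    (hd : ∀ x, HasDerivAt g (r * Real.exp (-(r * x)) * φ x) x)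
    (hg : Tendsto g atTop (𝓝 l)) :
    Integrable (fun x => if s < x then φ x else 0) (expMeasure r) ∧
      ∫ x, (if s < x then φ x else 0) ∂expMeasure r = l - g s := by
  have hpos : ∀ x ∈ Set.Ioi s, 0 ≤ r * Real.exp (-(r * x)) * φ x := fun x hx =>
    mul_nonneg (by positivity) (hφ x hx)
  have hlt : ∀ᵐ x ∂(volume : Measure ℝ), exponentialPDF r x < ⊤ :=
    ae_of_all _ fun x => ENNReal.ofReal_lt_top
  have e : (fun x => (exponentialPDF r x).toReal • (if s < x then φ x else 0)) =
      (Set.Ioi s).indicator fun x => r * Real.exp (-(r * x)) * φ x := by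
    ext x
    by_cases hx : s < x
    · rw [Set.indicator_of_mem (Set.mem_Ioi.2 hx), if_pos hx,
        toReal_exponentialPDF hr (hs.trans hx.le), smul_eq_mul]
    · rw [Set.indicator_of_notMem (by simpa using hx), if_neg hx, smul_zero]
  rw [expMeasure_eq]
  constructor
  · rw [integrable_withDensity_iff_integrable_smul' measurable_exponentialPDF hlt, e,
      integrable_indicator_iff measurableSet_Ioi]
    exact integrableOn_Ioi_deriv_of_nonneg' (fun x _ => hd x) hpos hg
  · rw [integral_withDensity_eq_integral_toReal_smul measurable_exponentialPDF hlt, e,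
      integral_indicator measurableSet_Ioi]
    exact integral_Ioi_of_hasDerivAt_of_nonneg' (fun x _ => hd x) hpos hg

lemma hasDerivAt_exp_neg_mul (x : ℝ) :
    HasDerivAt (fun x => Real.exp (-(r * x))) (-(r * Real.exp (-(r * x)))) x := by
  have := ((hasDerivAt_id x).const_mul r).neg.exp
  simpa [mul_comm] using this

lemma tendsto_pow_mul_exp_neg_mul (hr : 0 < r) (n : ℕ) :
    Tendsto (fun x : ℝ => x ^ n * Real.exp (-(r * x))) atTop (𝓝 0) := by
  have := tendsto_rpow_mul_exp_neg_mul_atTop_nhds_zero n r hr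
  simpa [neg_mul] using this

/-- The tail of the exponential law. -/
lemma integral_expMeasure_tail (hr : 0 < r) {s : ℝ} (hs : 0 ≤ s) :
    ∫ x, (if s < x then (1 : ℝ) else 0) ∂expMeasure r = Real.exp (-(r * s)) := by
  have h := integral_expMeasure_of_hasDerivAt hr hs (φ := fun _ => 1)
    (g := fun x => -Real.exp (-(r * x))) (l := 0) (fun _ _ => zero_le_one)
    (fun x => (hasDerivAt_exp_neg_mul (r := r) x).neg.congr_deriv (by ring))
    (by simpa using (tendsto_pow_mul_exp_neg_mul hr 0).neg)
  rw [h.2]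
  ring

/-- The expected overshoot of the exponential law beyond the level `s`. -/
lemma integral_expMeasure_overshoot (hr : 0 < r) {s : ℝ} (hs : 0 ≤ s) :
    Integrable (fun x => if s < x then x - s else 0) (expMeasure r) ∧
      ∫ x, (if s < x then x - s else 0) ∂expMeasure r = Real.exp (-(r * s)) / r := by
  have h := integral_expMeasure_of_hasDerivAt hr hs (φ := fun x => x - s)
    (g := fun x => (s - 1 / r - x) * Real.exp (-(r * x))) (l := 0)
    (fun x hx => by simpa using hx.le)
    (fun x => by
      have := ((hasDerivAt_id x).const_sub (s - 1 / r)).mul (hasDerivAt_exp_neg_mul (r := r) x)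
      refine this.congr_deriv ?_
      simp only [id]
      field_simp
      ring)
    (by
      have := ((tendsto_pow_mul_exp_neg_mul hr 0).const_mul (s - 1 / r)).sub
        (tendsto_pow_mul_exp_neg_mul hr 1)
      simp only [mul_zero, sub_zero] at this
      refine this.congr fun x => ?_
      ring)
  refine ⟨h.1, h.2.trans ?_⟩
  field_simp
  ring

lemma integral_id_expMeasure (hr : 0 < r) : ∫ x, x ∂expMeasure r = 1 / r := by
  have h := (integral_expMeasure_overshoot hr le_rfl).2
  rw [mul_zero, neg_zero, Real.exp_zero] at h
  rw [← h]
  refine integral_congr_ae ?_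
  filter_upwards [ae_pos_expMeasure] with x hx
  simp [hx]

lemma integral_sq_expMeasure (hr : 0 < r) :
    Integrable (fun x => x ^ 2) (expMeasure r) ∧ ∫ x, x ^ 2 ∂expMeasure r = 2 / r ^ 2 := by
  have h := integral_expMeasure_of_hasDerivAt hr le_rfl (φ := fun x => x ^ 2)
    (g := fun x => -(x ^ 2 + 2 / r * x + 2 / r ^ 2) * Real.exp (-(r * x))) (l := 0)
    (fun x _ => sq_nonneg x)
    (fun x => by
      have := ((((hasDerivAt_id x).pow 2).add ((hasDerivAt_id x).const_mul (2 / r))).add_const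
        (2 / r ^ 2)).neg.mul (hasDerivAt_exp_neg_mul (r := r) x)
      refine this.congr_deriv ?_
      simp
      field_simp
      ring)
    (by
      have := (((tendsto_pow_mul_exp_neg_mul hr 2).add
        ((tendsto_pow_mul_exp_neg_mul hr 1).const_mul (2 / r))).add
        ((tendsto_pow_mul_exp_neg_mul hr 0).const_mul (2 / r ^ 2))).neg
      simp only [mul_zero, add_zero, neg_zero] at this
      refine this.congr fun x => ?_
      ring)
  have hae : (fun x : ℝ => if 0 < x then x ^ 2 else 0) =ᵐ[expMeasure r] fun x => x ^ 2 := by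
    filter_upwards [ae_pos_expMeasure] with x hx
    simp [hx]
  refine ⟨h.1.congr hae, ?_⟩
  rw [← integral_congr_ae hae, h.2]
  simp

lemma memLp_id_expMeasure (hr : 0 < r) : MemLp (fun x : ℝ => x) 2 (expMeasure r) :=
  (memLp_two_iff_integrable_sq measurable_id.aestronglyMeasurable).2 (integral_sq_expMeasure hr).1

end Exponential

/-! ### Expectations under the law of one innovation -/

section InnovationLaw

variable {M : ℕ} {r : ℝ} {ν : Measure ℝ} {p : Fin M → ℝ} {i : Fin M}

lemma isProbabilityMeasure_streamLaw (hp : ∀ i, 0 ≤ p i) (hp_sum : ∑ i, p i = 1) :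
    IsProbabilityMeasure (streamLaw p) := by
  constructor
  simp [streamLaw, ← ENNReal.ofReal_sum_of_nonneg fun i _ => hp i, hp_sum]

lemma integral_streamLaw (hp : ∀ i, 0 ≤ p i) (f : Fin M → ℝ) :
    ∫ j, f j ∂streamLaw p = ∑ j, p j * f j := by
  rw [streamLaw, integral_finsetSum_measure fun j _ =>
    (integrable_dirac (by simp)).smul_measure ENNReal.ofReal_ne_top]
  refine Finset.sum_congr rfl fun j _ => ?_
  rw [integral_smul_measure, integral_dirac, ENNReal.toReal_ofReal (hp j), smul_eq_mul]

/-- The law of the innovation `(X (n + 1), S n, c n)`. -/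
noncomputable def innovationLaw (r : ℝ) (ν : Measure ℝ) (p : Fin M → ℝ) : Measure (ℝ × ℝ × Fin M) :=
  (expMeasure r).prod (ν.prod (streamLaw p))

/-- The probability that an update is received. -/
noncomputable def successProb (r : ℝ) (ν : Measure ℝ) : ℝ := ∫ s, Real.exp (-(r * s)) ∂ν

/-- The expectation of the service time on the event that the update is received. -/
noncomputable def successService (r : ℝ) (ν : Measure ℝ) : ℝ :=
  ∫ z, (if z.2 < z.1 then z.2 else 0) ∂(expMeasure r).prod ν

/-- The indicator of the reception of an update of stream `i`. -/
noncomputable def success (i : Fin M) (y : ℝ × ℝ × Fin M) : ℝ := if y.2.2 = i ∧ y.2.1 < y.1 then 1 else 0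

/-- The time until the next generation of an update, cut off when an update of stream `i` is
received. -/
noncomputable def outdatedTime (i : Fin M) (y : ℝ × ℝ × Fin M) : ℝ := y.1 - success i y * (y.1 - y.2.1)

lemma measurableSet_success (i : Fin M) :
    MeasurableSet {y : ℝ × ℝ × Fin M | y.2.2 = i ∧ y.2.1 < y.1} :=
  (measurable_snd.snd (measurableSet_singleton i)).inter
    (measurableSet_lt measurable_snd.fst measurable_fst)

lemma measurable_success (i : Fin M) : Measurable (success i) :=
  Measurable.ite (measurableSet_success i) measurable_const measurable_const

lemma measurable_outdatedTime (i : Fin M) : Measurable (outdatedTime i) :=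
  measurable_fst.sub ((measurable_success i).mul (measurable_fst.sub measurable_snd.fst))

lemma success_eq_zero_or_one (i : Fin M) (y : ℝ × ℝ × Fin M) :
    success i y = 0 ∨ success i y = 1 := by
  unfold success; split_ifs <;> simp

lemma successProb_pos (hr : 0 < r) [IsProbabilityMeasure ν] (hν : ν (Set.Iio 0) = 0) :
    0 < successProb r ν := by
  have hnn : ∀ᵐ s ∂ν, 0 ≤ s := by
    rw [ae_iff]; simpa [Set.Iio] using hν
  have hi : Integrable (fun s => Real.exp (-(r * s))) ν := by
    refine Integrable.of_bound (by fun_prop) 1 ?_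
    filter_upwards [hnn] with s hs
    rw [Real.norm_eq_abs, Real.abs_exp, Real.exp_le_one_iff]
    nlinarith
  exact integral_exp_pos hi

/-- By Fubini with the service time fixed, the inner integrals are the exponential tail and, by lack
of memory, that tail times `1 / r`. -/
lemma integral_prod_ite_lt (hr : 0 < r) [IsProbabilityMeasure ν] (hν : ν (Set.Iio 0) = 0) :
    ∫ z, (if z.2 < z.1 then (1 : ℝ) else 0) ∂(expMeasure r).prod ν = successProb r ν ∧
    ∫ z, (if z.2 < z.1 then z.1 - z.2 else 0) ∂(expMeasure r).prod ν = successProb r ν / r := by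
  have := isProbabilityMeasure_expMeasure hr
  have hnn : ∀ᵐ s ∂ν, 0 ≤ s := by
    rw [ae_iff]; simpa [Set.Iio] using hν
  have hms : MeasurableSet {z : ℝ × ℝ | z.2 < z.1} := measurableSet_lt measurable_snd measurable_fst
  have hX : Integrable (fun z : ℝ × ℝ => z.1) ((expMeasure r).prod ν) :=
    ((memLp_id_expMeasure hr).integrable one_le_two).comp_fst ν
  constructor
  · rw [integral_prod_symm]
    · exact integral_congr_ae (by
        filter_upwards [hnn] with s hs using integral_expMeasure_tail hr hs)
    · exact Integrable.of_bound (Measurable.ite hms measurable_const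
        measurable_const).aestronglyMeasurable 1 (ae_of_all _ fun z => by split_ifs <;> simp)
  · rw [integral_prod_symm, successProb, ← integral_div]
    · exact integral_congr_ae (by
        filter_upwards [hnn] with s hs using (integral_expMeasure_overshoot hr hs).2)
    · refine hX.mono (Measurable.ite hms (measurable_fst.sub measurable_snd)
        measurable_const).aestronglyMeasurable ?_
      have : ∀ᵐ z ∂(expMeasure r).prod ν, 0 ≤ z.2 :=
        Measure.quasiMeasurePreserving_snd.ae hnn
      filter_upwards [this] with z hz
      split_ifs with h
      · rw [Real.norm_eq_abs, Real.norm_eq_abs, abs_of_nonneg (by linarith),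
          abs_of_nonneg (by linarith)]
        linarith
      · simp

lemma isProbabilityMeasure_innovationLaw (hr : 0 < r) [IsProbabilityMeasure ν]
    (hp : ∀ i, 0 ≤ p i) (hp_sum : ∑ i, p i = 1) : IsProbabilityMeasure (innovationLaw r ν p) := by
  have := isProbabilityMeasure_expMeasure hr
  have := isProbabilityMeasure_streamLaw hp hp_sum
  unfold innovationLaw
  infer_instance

lemma integral_innovationLaw_stream (hr : 0 < r) [IsProbabilityMeasure ν] (hp : ∀ i, 0 ≤ p i)
    (hp_sum : ∑ i, p i = 1) (φ : ℝ × ℝ → ℝ) :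
    ∫ y, (if y.2.2 = i then φ (y.1, y.2.1) else 0) ∂innovationLaw r ν p =
      p i * ∫ z, φ z ∂(expMeasure r).prod ν := by
  have := isProbabilityMeasure_expMeasure hr
  have := isProbabilityMeasure_streamLaw hp hp_sum
  have h := (measurePreserving_prodAssoc (expMeasure r) ν (streamLaw p)).integral_comp'
    (fun y : ℝ × ℝ × Fin M => if y.2.2 = i then φ (y.1, y.2.1) else 0)
  rw [innovationLaw, ← h]
  have e : ∀ z : (ℝ × ℝ) × Fin M,
      (if (MeasurableEquiv.prodAssoc z).2.2 = i then
        φ ((MeasurableEquiv.prodAssoc z).1, (MeasurableEquiv.prodAssoc z).2.1) else 0) =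
      φ z.1 * (if z.2 = i then 1 else 0) := fun z => by
    simp [MeasurableEquiv.prodAssoc]
  simp_rw [e]
  rw [integral_prod_mul φ (fun j => if j = i then (1 : ℝ) else 0), integral_streamLaw hp]
  simp [mul_comm]

lemma ae_innovationLaw (hr : 0 < r) [IsProbabilityMeasure ν] (hν : ν (Set.Iio 0) = 0)
    (hp : ∀ i, 0 ≤ p i) (hp_sum : ∑ i, p i = 1) :
    ∀ᵐ y ∂innovationLaw r ν p, 0 < y.1 ∧ 0 ≤ y.2.1 := by
  have := isProbabilityMeasure_expMeasure hr
  have := isProbabilityMeasure_streamLaw hp hp_sum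
  have hnn : ∀ᵐ s ∂ν, 0 ≤ s := by
    rw [ae_iff]; simpa [Set.Iio] using hν
  have h1 : ∀ᵐ y ∂innovationLaw r ν p, 0 < y.1 :=
    Measure.quasiMeasurePreserving_fst.ae ae_pos_expMeasure
  have h2 : ∀ᵐ y ∂innovationLaw r ν p, 0 ≤ y.2.1 :=
    Measure.quasiMeasurePreserving_snd.ae (Measure.quasiMeasurePreserving_fst.ae hnn)
  exact h1.and h2

lemma memLp_interarrival (hr : 0 < r) [IsProbabilityMeasure ν]
    (hp : ∀ i, 0 ≤ p i) (hp_sum : ∑ i, p i = 1) :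
    MemLp (fun y : ℝ × ℝ × Fin M => y.1) 2 (innovationLaw r ν p) := by
  have := isProbabilityMeasure_expMeasure hr
  have := isProbabilityMeasure_streamLaw hp hp_sum
  exact (memLp_id_expMeasure hr).comp_measurePreserving measurePreserving_fst

lemma integral_interarrival (hr : 0 < r) [IsProbabilityMeasure ν]
    (hp : ∀ i, 0 ≤ p i) (hp_sum : ∑ i, p i = 1) :
    ∫ y, y.1 ∂innovationLaw r ν p = 1 / r ∧ ∫ y, y.1 ^ 2 ∂innovationLaw r ν p = 2 / r ^ 2 := by
  have := isProbabilityMeasure_expMeasure hr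
  have := isProbabilityMeasure_streamLaw hp hp_sum
  constructor
  · rw [← integral_id_expMeasure hr, innovationLaw, integral_fun_fst (fun x => x)]
    simp
  · rw [← (integral_sq_expMeasure hr).2, innovationLaw, integral_fun_fst (fun x => x ^ 2)]
    simp

/-- A received update has a service time below the interarrival time. This domination gives square
integrability without moments of `ν`. -/
lemma norm_success_mul_le {y : ℝ × ℝ × Fin M} (hy : 0 < y.1 ∧ 0 ≤ y.2.1) :
    ‖success i y * y.2.1‖ ≤ ‖y.1‖ ∧ ‖outdatedTime i y‖ ≤ ‖y.1‖ := by
  unfold outdatedTime success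
  have hx := abs_of_pos hy.1
  split_ifs with h
  · have := h.2
    simp only [one_mul, Real.norm_eq_abs, sub_sub_cancel, abs_of_nonneg hy.2, hx]
    exact ⟨this.le, this.le⟩
  · simp

lemma memLp_success_mul (hr : 0 < r) [IsProbabilityMeasure ν] (hν : ν (Set.Iio 0) = 0)
    (hp : ∀ i, 0 ≤ p i) (hp_sum : ∑ i, p i = 1) :
    MemLp (fun y => success i y * y.2.1) 2 (innovationLaw r ν p) ∧
      MemLp (outdatedTime i) 2 (innovationLaw r ν p) := by
  have h := ae_innovationLaw hr hν hp hp_sum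
  have hX := memLp_interarrival (ν := ν) hr hp hp_sum
  exact ⟨hX.mono ((measurable_success i).mul measurable_snd.fst).aestronglyMeasurable
    (h.mono fun y hy => (norm_success_mul_le hy).1),
    hX.mono (measurable_outdatedTime i).aestronglyMeasurable
    (h.mono fun y hy => (norm_success_mul_le hy).2)⟩

lemma integral_success (hr : 0 < r) [IsProbabilityMeasure ν] (hν : ν (Set.Iio 0) = 0)
    (hp : ∀ i, 0 ≤ p i) (hp_sum : ∑ i, p i = 1) :
    ∫ y, success i y ∂innovationLaw r ν p = p i * successProb r ν ∧
    ∫ y, success i y * y.2.1 ∂innovationLaw r ν p = p i * successService r ν ∧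
    ∫ y, outdatedTime i y ∂innovationLaw r ν p = 1 / r - p i * successProb r ν / r := by
  have := isProbabilityMeasure_innovationLaw (ν := ν) hr hp hp_sum
  have hq := integral_prod_ite_lt hr hν
  have hX := (memLp_interarrival (ν := ν) hr hp hp_sum).integrable one_le_two
  have hg := (memLp_success_mul (i := i) hr hν hp hp_sum).2.integrable one_le_two
  refine ⟨?_, ?_, ?_⟩
  · rw [← hq.1, ← integral_innovationLaw_stream hr hp hp_sum]
    refine integral_congr_ae (ae_of_all _ fun y => ?_)
    simp only [success, ite_and]
  · rw [successService, ← integral_innovationLaw_stream hr hp hp_sum]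
    refine integral_congr_ae (ae_of_all _ fun y => ?_)
    simp only [success, ite_and, ite_mul, one_mul, zero_mul]
  · have e : ∫ y, success i y * (y.1 - y.2.1) ∂innovationLaw r ν p =
        p i * (successProb r ν / r) := by
      rw [← hq.2, ← integral_innovationLaw_stream hr hp hp_sum]
      refine integral_congr_ae (ae_of_all _ fun y => ?_)
      simp only [success, ite_and, ite_mul, one_mul, zero_mul]
    have hi : Integrable (fun y => success i y * (y.1 - y.2.1)) (innovationLaw r ν p) := by
      refine (hX.sub hg).congr (ae_of_all _ fun y => ?_)
      simp [outdatedTime]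
    simp only [outdatedTime]
    rw [integral_sub hX hi, e, (integral_interarrival hr hp hp_sum).1, mul_div_assoc]

end InnovationLaw

/-! ### The age as a function of the innovations -/

section InnovationPath

variable {Ω : Type*} {M : ℕ} {X S : ℕ → Ω → ℝ} {c : ℕ → Ω → Fin M} {i : Fin M} {u₀ : ℝ}

/-- The data which become known between the generations of updates `n` and `n + 1`: the
interarrival time, and the service time and the stream of update `n`. -/
def innovation (X S : ℕ → Ω → ℝ) (c : ℕ → Ω → Fin M) (n : ℕ) (ω : Ω) : ℝ × ℝ × Fin M :=
  (X (n + 1) ω, S n ω, c n ω)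

lemma genTime_eq_sum_innovation (n : ℕ) (ω : Ω) : genTime (X · ω) n =
    X 0 ω + ∑ k ∈ Finset.range n, (innovation X S c k ω).1 := by
  rw [genTime, Finset.sum_range_succ', add_comm]
  rfl

lemma successful_iff (n : ℕ) (ω : Ω) : Successful (X · ω) (S · ω) (c · ω) i n ↔
    (innovation X S c n ω).2.2 = i ∧ (innovation X S c n ω).2.1 < (innovation X S c n ω).1 := by
  unfold Successful deliveryTime innovation
  rw [genTime_succ]
  simp

open Classical in
lemma success_innovation (n : ℕ) (ω : Ω) : success i (innovation X S c n ω) =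
    if Successful (X · ω) (S · ω) (c · ω) i n then 1 else 0 := by
  unfold success
  simp only [successful_iff]

lemma ageArea_eq (n : ℕ) (ω : Ω) : ageArea (X · ω) (S · ω) (c · ω) u₀ i n =
    ageAt (X · ω) (S · ω) (c · ω) u₀ i n * outdatedTime i (innovation X S c n ω) +
      (innovation X S c n ω).1 ^ 2 / 2 := by
  classical
  unfold ageArea outdatedTime
  rw [success_innovation]
  simp only [innovation]
  split_ifs <;> ring

/-- From the first reception on, the age does not depend on its initial value. -/
lemma eventually_ageAt_eq_chain {k : ℕ} {ω : Ω}
    (hk : Successful (X · ω) (S · ω) (c · ω) i k) :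
    ∀ᶠ n in atTop, ageAt (X · ω) (S · ω) (c · ω) u₀ i n =
      chain (success i) (fun y => y.1) (innovation X S c) n ω := by
  classical
  filter_upwards [eventually_ge_atTop (k + 1)] with n hn
  induction n, hn using Nat.le_induction with
  | base =>
    simp only [ageAt_succ, chain, success_innovation, if_pos hk]
    simp [innovation]
  | succ n _ ih =>
    simp only [ageAt_succ, chain, success_innovation, ← ih]
    split_ifs <;> simp [innovation]

end InnovationPath

/-! ### Almost sure averages for the source -/

section Source

variable {Ω : Type*} [MeasurableSpace Ω] {P : Measure Ω} {M : ℕ} {r : ℝ}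
  {ν : Measure ℝ} {p : Fin M → ℝ} {X S : ℕ → Ω → ℝ} {c : ℕ → Ω → Fin M} {i : Fin M}

lemma IsSource.measurable_innovation (h : IsSource P r ν p X S c) (n : ℕ) :
    Measurable (innovation X S c n) :=
  (h.measurable_interarrival _).prodMk ((h.measurable_service n).prodMk (h.measurable_stream n))

lemma IsSource.map_interarrival [IsProbabilityMeasure ν] (h : IsSource P r ν p X S c) (hr : 0 < r)
    (hp : ∀ i, 0 ≤ p i) (hp_sum : ∑ i, p i = 1) (n : ℕ) :
    P.map (X n) = expMeasure r ∧
      P.map (fun ω => (S n ω, c n ω)) = ν.prod (streamLaw p) := by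
  have := isProbabilityMeasure_expMeasure hr
  have := isProbabilityMeasure_streamLaw hp hp_sum
  have hB := (h.measurable_service n).prodMk (h.measurable_stream n)
  have hm := (h.measurable_interarrival n).prodMk hB
  have h1 := congrArg Measure.fst (h.law n)
  have h2 := congrArg Measure.snd (h.law n)
  rw [Measure.fst_prod, Measure.fst_map_prodMk hB] at h1
  rw [Measure.snd_prod, Measure.snd_map_prodMk (h.measurable_interarrival n)] at h2
  exact ⟨h1, h2⟩

/-- The fate of update `n` depends on the next interarrival time, so the i.i.d. triples of the
source must be regrouped with `X` shifted by one. -/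
lemma IsSource.innovation_iid [IsProbabilityMeasure P] [IsProbabilityMeasure ν]
    (h : IsSource P r ν p X S c) (hr : 0 < r)
    (hp : ∀ i, 0 ≤ p i) (hp_sum : ∑ i, p i = 1) :
    iIndepFun (innovation X S c) P ∧ ∀ n, P.map (innovation X S c n) = innovationLaw r ν p := by
  have hB := fun n => (h.measurable_service n).prodMk (h.measurable_stream n)
  have hA := h.measurable_interarrival
  have hlaw := h.map_interarrival hr hp hp_sum
  constructor
  · refine iIndepFun_shift hA hB h.indep fun n => ?_
    rw [indepFun_iff_map_prod_eq_prod_map_map (hA n).aemeasurable (hB n).aemeasurable,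
      (hlaw n).1, (hlaw n).2]
    exact h.law n
  · intro n
    have hi : IndepFun (X (n + 1)) (fun ω => (S n ω, c n ω)) P :=
      (h.indep.indepFun n.succ_ne_self).comp measurable_fst measurable_snd
    rw [indepFun_iff_map_prod_eq_prod_map_map (hA _).aemeasurable (hB n).aemeasurable,
      (hlaw _).1, (hlaw n).2] at hi
    exact hi

lemma IsSource.ae_pos [IsProbabilityMeasure ν] (h : IsSource P r ν p X S c) (hr : 0 < r)
    (hν : ν (Set.Iio 0) = 0) (hp : ∀ i, 0 ≤ p i) (hp_sum : ∑ i, p i = 1) :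
    ∀ᵐ ω ∂P, (∀ n, 0 < X n ω) ∧ ∀ n, 0 ≤ S n ω := by
  rw [eventually_and, ae_all_iff, ae_all_iff]
  have hlaw : ∀ n, P.map (fun ω => (X n ω, S n ω, c n ω)) = innovationLaw r ν p := h.law
  have key : ∀ n, ∀ᵐ ω ∂P, 0 < X n ω ∧ 0 ≤ S n ω := fun n => by
    have h1 := ae_innovationLaw (p := p) hr hν hp hp_sum
    rw [← hlaw n] at h1
    exact ae_of_ae_map ((h.measurable_interarrival n).prodMk
      ((h.measurable_service n).prodMk (h.measurable_stream n))).aemeasurable h1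
  exact ⟨fun n => (key n).mono fun _ h => h.1, fun n => (key n).mono fun _ h => h.2⟩

/-- The average age and the average peak age of a stream which is chosen with positive
probability. -/
theorem IsSource.hasAverageAge [IsProbabilityMeasure P] [IsProbabilityMeasure ν]
    (h : IsSource P r ν p X S c) (hr : 0 < r) (hν : ν (Set.Iio 0) = 0)
    (hp : ∀ i, 0 ≤ p i) (hp_sum : ∑ i, p i = 1) (hi : 0 < p i) (u₀ : ℝ) :
    HasAverageAge P X S c u₀ i (1 / (r * successProb r ν) / p i) ∧
      HasAveragePeakAge P X S c u₀ i
        (1 / (r * successProb r ν) / p i + successService r ν / successProb r ν) := by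
  classical
  have hY := h.measurable_innovation
  obtain ⟨hind, hlaw⟩ := h.innovation_iid hr hp hp_sum
  have := isProbabilityMeasure_innovationLaw (ν := ν) hr hp hp_sum
  have hq := successProb_pos hr hν
  obtain ⟨hint1, hint2, hint3⟩ := integral_success (i := i) hr hν hp hp_sum
  obtain ⟨hintX, hintX2⟩ := integral_interarrival (ν := ν) hr hp hp_sum
  have hX := memLp_interarrival (ν := ν) hr hp hp_sum
  obtain ⟨hsL, hgL⟩ := memLp_success_mul (i := i) hr hν hp hp_sum
  have hχpos : 0 < ∫ y, success i y ∂innovationLaw r ν p := by rw [hint1]; positivity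
  have hχi : Integrable (success i) (innovationLaw r ν p) := by
    by_contra hn
    exact hχpos.ne' (integral_undef hn)
  have key : ∀ᵐ ω ∂P, {n | Successful (X · ω) (S · ω) (c · ω) i n}.Infinite ∧
      Tendsto (fun τ : ℝ => 1 / τ * ∫ t in (0 : ℝ)..τ, age (X · ω) (S · ω) (c · ω) u₀ i t) atTop
        (𝓝 (1 / (r * successProb r ν) / p i)) ∧
      Tendsto (fun N : ℕ =>
        1 / (N : ℝ) * ∑ j ∈ Finset.range N, peakAge (X · ω) (S · ω) (c · ω) u₀ i j) atTop
        (𝓝 (1 / (r * successProb r ν) / p i + successService r ν / successProb r ν)) := by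
    filter_upwards [h.ae_pos hr hν hp hp_sum,
      ae_tendsto_average hY hind hlaw (measurable_success i) hχi,
      ae_tendsto_average hY hind hlaw measurable_fst (hX.integrable one_le_two),
      ae_tendsto_average hY hind hlaw (measurable_fst.pow_const 2) hX.integrable_sq,
      ae_tendsto_average hY hind hlaw ((measurable_success i).mul measurable_snd.fst)
        (hsL.integrable one_le_two),
      ae_tendsto_chain_div hY hind hlaw (measurable_success i) (success_eq_zero_or_one i) hχpos
        measurable_fst hX,
      ae_tendsto_average_chain_mul hY hind hlaw (measurable_success i) (success_eq_zero_or_one i)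
        hχpos measurable_fst hX (measurable_outdatedTime i) hgL]
      with ω ⟨hx, hs⟩ hχ hf hf2 hσ ha hg
    simp only [Pi.mul_apply] at hσ
    rw [hint1] at hχ hg
    rw [hintX] at hf hg
    rw [hint3] at hg
    rw [hint2] at hσ
    rw [hintX2] at hf2
    simp only [success_innovation, ite_mul, one_mul, zero_mul] at hχ hσ
    have hpq : 0 < p i * successProb r ν := by positivity
    have hinf := infinite_of_tendsto_average hpq hχ
    obtain ⟨k, hk : Successful (X · ω) (S · ω) (c · ω) i k⟩ := hinf.nonempty
    have hev := eventually_ageAt_eq_chain (u₀ := u₀) hk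
    have ht : Tendsto (fun n : ℕ => genTime (X · ω) n / n) atTop (𝓝 (1 / r)) := by
      have := (tendsto_const_div_atTop_nhds_zero_nat (X 0 ω)).add hf
      rw [zero_add] at this
      refine this.congr fun n => ?_
      rw [genTime_eq_sum_innovation (S := S) (c := c), add_div]
    have ha' : Tendsto (fun n : ℕ => ageAt (X · ω) (S · ω) (c · ω) u₀ i n / n) atTop (𝓝 0) :=
      ha.congr' (by filter_upwards [hev] with n hn; rw [hn])
    refine ⟨hinf, ?_, ?_⟩
    -- The true age and the chain started at `0` agree after the first success, so replacing one by
    -- the other does not change the average.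
    · have h0 := tendsto_average_of_eventually_zero (u := fun k =>
        (ageAt (X · ω) (S · ω) (c · ω) u₀ i k - chain (success i) (fun y => y.1)
          (innovation X S c) k ω) * outdatedTime i (innovation X S c k ω))
        (by filter_upwards [hev] with n hn; rw [hn, sub_self, zero_mul])
      have h1 := (h0.add hg).add (hf2.div_const 2)
      have h2 := tendsto_average_age (u₀ := u₀) hx hs hk (one_div_pos.2 hr) ht (h1.congr fun n => by
        simp only [ageArea_eq, sub_mul, Finset.sum_sub_distrib, Finset.sum_add_distrib,
          ← Finset.sum_div]
        ring)
      -- With `π = p i * q`, the mean area is `(1 / r - π / r) * (1 / r) / π + 1 / r ^ 2 = 1 / (r ^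
      -- 2 * π)`, to be divided by the mean interarrival time `1 / r`.
      convert h2 using 2
      field_simp
      ring
    · have h1 := tendsto_average_peakAge (u₀ := u₀) hx hs hpq ht ha' hχ hσ
      convert h1 using 2
      field_simp
  exact ⟨key.mono fun ω h => h.2.1, key.mono fun ω h => ⟨h.1, h.2.2⟩⟩

end Source

end StatusUpdate

/-! ### Comparison of the closed forms -/

/-- Two systems with the same total generation rate `r` and the same service time law `ν`, but with
possibly different choice probabilities `p` and `p'`. -/
theorem mainTheorem3 {M : ℕ} (r : ℝ) (hr : 0 < r)
    (ν : Measure ℝ) [IsProbabilityMeasure ν] (hν : ν (Set.Iio 0) = 0)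
    (p p' : Fin M → ℝ)
    (hp : ∀ i, 0 ≤ p i) (hp_sum : ∑ i, p i = 1)
    (hp' : ∀ i, 0 ≤ p' i) (hp'_sum : ∑ i, p' i = 1)
    {Ω : Type*} [MeasurableSpace Ω] (P : Measure Ω) [IsProbabilityMeasure P]
    (X S : ℕ → Ω → ℝ) (c : ℕ → Ω → Fin M)
    (hsrc : StatusUpdate.IsSource P r ν p X S c) (u₀ : Fin M → ℝ)
    {Ω' : Type*} [MeasurableSpace Ω'] (P' : Measure Ω') [IsProbabilityMeasure P']
    (X' S' : ℕ → Ω' → ℝ) (c' : ℕ → Ω' → Fin M)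
    (hsrc' : StatusUpdate.IsSource P' r ν p' X' S' c') (u₀' : Fin M → ℝ) :
    ∃ Δ Δpeak Δ' Δpeak' : Fin M → ℝ,
      -- the average ages and the average peak ages of both systems
      (∀ i, 0 < p i → StatusUpdate.HasAverageAge P X S c (u₀ i) i (Δ i) ∧
        StatusUpdate.HasAveragePeakAge P X S c (u₀ i) i (Δpeak i)) ∧
      (∀ i, 0 < p' i → StatusUpdate.HasAverageAge P' X' S' c' (u₀' i) i (Δ' i) ∧
        StatusUpdate.HasAveragePeakAge P' X' S' c' (u₀' i) i (Δpeak' i)) ∧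
      -- comparison of two streams of one system
      (∀ i k, 0 < p i → 0 < p k →
        (Δ k < Δ i ↔ p i < p k) ∧ (Δpeak k < Δpeak i ↔ p i < p k)) ∧
      -- comparison of a stream with itself when the choice probabilities change
      (∀ k, 0 < p k → 0 < p' k →
        (Δ' k < Δ k ↔ p k < p' k) ∧ (Δpeak' k < Δpeak k ↔ p k < p' k)) ∧
      -- raising `p k` prioritizes stream `k` over every stream that is not raised as well
      (∀ k j, 0 < p k → 0 < p' j → p k < p' k → p' j ≤ p j →
        Δ' k - Δ' j < Δ k - Δ j ∧ Δpeak' k - Δpeak' j < Δpeak k - Δpeak j) := by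
  open StatusUpdate in
  have hq := successProb_pos hr hν
  -- Both `C` and `b` depend only on `r` and `ν`, hence are shared by the two systems.
  set C := 1 / (r * successProb r ν)
  set b := successService r ν / successProb r ν
  have hCpos : 0 < C := by positivity
  have hlt : ∀ {x y : ℝ}, 0 < x → 0 < y → (C / x < C / y ↔ y < x) := fun hx hy =>
    div_lt_div_iff_of_pos_left hCpos hx hy
  have hlt' : ∀ {x y : ℝ}, 0 < x → 0 < y → (C / x + b < C / y + b ↔ y < x) := fun hx hy =>
    (add_lt_add_iff_right b).trans (hlt hx hy)
  refine ⟨fun i => C / p i, fun i => C / p i + b, fun i => C / p' i, fun i => C / p' i + b,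
    fun i hi => hsrc.hasAverageAge hr hν hp hp_sum hi (u₀ i),
    fun i hi => hsrc'.hasAverageAge hr hν hp' hp'_sum hi (u₀' i),
    fun i k hi hk => ⟨hlt hk hi, hlt' hk hi⟩, fun k hk hk' => ⟨hlt hk' hk, hlt' hk' hk⟩,
    fun k j hk hj hkk hjj => ?_⟩
  -- The term of stream `k` strictly decreases, that of stream `j` does not, and `b` cancels in the
  -- differences of peak ages.
  have h1 := (hlt (hk.trans hkk) hk).2 hkk
  have h2 : C / p j ≤ C / p' j := div_le_div_of_nonneg_left hCpos.le hj hjj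
  constructor <;> linarith
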